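/- Let $M$ be a smooth manifold (without boundary) with a foliation $\mathcal F$, let $T\mathcal F\subset TM$ be its tangent bundle, and let $\nu\mathcal F$ be a transversal distribution, i.e. a smooth distribution with $TM=T\mathcal F\oplus\nu\mathcal F$. For an open set $W\subseteq M$ let $\Omega_{0,k}(W)$ be the space of smooth $k$-forms on $W$ that vanish as soon as one of their arguments lies in $\nu\mathcal F$, and let $d'':\Omega_{0,k}(W)\to\Omega_{0,k+1}(W)$ be the leafwise differential, i.e. the component of type $(0,k+1)$ of the de Rham differential with respect to this splitting. Let $$H^k(W,P^0(\mathcal F|_W))=\frac{\ker(d'':\Omega_{0,k}(W)\to\Omega_{0,k+1}(W))}{\operatorname{im}(d'':\Omega_{0,k-1}(W)\to\Omega_{0,k}(W))}$$ be the leafwise de Rham cohomology of $W$, and let $P^0(\mathcal F)$ be the sheaf whose sections over $W$ are the smooth functions on $W$ that are constant along the leaves of the foliation $\mathcal F|_W$ induced on $W$. Let $\mathcal U=(U_i)_{i\in I}$ be a good covering of $M$, i.e. a locally finite open covering with $H^q(U_{i_1}\cap\dots\cap U_{i_m},P^0(\mathcal F|_{U_{i_1}\cap\dots\cap U_{i_m}}))=0$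 for all $q>0$, all $m\ge 1$ and all $i_1,\dots,i_m\in I$, and let $(h_i)_{i\in I}$ be a smooth partition of unity subordinate to $\mathcal U$. Let $\check H^k(\mathcal U,P^0(\mathcal F))$ be the cohomology of the Čech complex of $P^0(\mathcal F)$ with respect to $\mathcal U$, whose $k$-cochains are the families $c=(c_{i_0\dots i_k})$ with $c_{i_0\dots i_k}$ a section of $P^0(\mathcal F)$ over $U_{i_0}\cap\dots\cap U_{i_k}$. Then for every $k\ge 0$ and every Čech $k$-cocycle $c$ there is a (unique) $d''$-closed form $\omega_c\in\Omega_{0,k}(M)$ such that for all $i\in I$ $$\omega_c|_{U_i}=(-1)^{\frac{k(k+1)}2}\sum_{i_1,\dots,i_k\in I}c_{i_1\dots i_k\,i}\;d''h_{i_1}\wedge\dots\wedge d''h_{i_k}$$ (terms being extended by zero outside $U_{i_1}\cap\dots\cap U_{i_k}\cap U_i$), and $[c]\mapsto[\omega_c]$ is a well-defined linear isomorphism $\check H^k(\mathcal U,P^0(\mathcal F))\to H^k(M,P^0(\mathcal F))$. -/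

import Mathlib

open scoped Manifold ContDiff Topology

noncomputable section

/-- A foliation of dimension `p` and codimension `q` on the smooth manifold `M` (without boundary,
modelled on the finite-dimensional space `E`), given by an atlas of distinguished charts
`M ⊇ source → ℝ^p × ℝ^q`.  The charts belong to the smooth structure of `M`, and near every point
of a common domain the change of charts has the form `(a, b) ↦ (f (a, b), g b)`. -/
structure Foliation (E : Type*) [NormedAddCommGroup E] [NormedSpace ℝ E]
    (M : Type*) [TopologicalSpace M] [ChartedSpace E M] (p q : ℕ) where
  charts : Set (OpenPartialHomeomorph M (EuclideanSpace ℝ (Fin p) × EuclideanSpace ℝ (Fin q)))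
  covers : ∀ x : M, ∃ φ ∈ charts, x ∈ φ.source
  smooth : ∀ φ ∈ charts,
    ContMDiffOn 𝓘(ℝ, E) 𝓘(ℝ, EuclideanSpace ℝ (Fin p) × EuclideanSpace ℝ (Fin q)) ∞ φ φ.source
  smooth_symm : ∀ φ ∈ charts,
    ContMDiffOn 𝓘(ℝ, EuclideanSpace ℝ (Fin p) × EuclideanSpace ℝ (Fin q)) 𝓘(ℝ, E) ∞
      φ.symm φ.target
  compatible : ∀ φ ∈ charts, ∀ ψ ∈ charts, ∀ x ∈ φ.source ∩ ψ.source,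
    ∃ g : EuclideanSpace ℝ (Fin q) → EuclideanSpace ℝ (Fin q),
      ∀ᶠ y in 𝓝 x, (ψ y).2 = g (φ y).2

/-- Fields of alternating `k`-forms on the tangent spaces of `M` (no smoothness imposed). -/
def FormField (E : Type*) [NormedAddCommGroup E] [NormedSpace ℝ E]
    (M : Type*) [TopologicalSpace M] [ChartedSpace E M] (k : ℕ) : Type _ :=
  (x : M) → TangentSpace 𝓘(ℝ, E) x [⋀^Fin k]→L[ℝ] ℝ

namespace FormField

variable {E : Type*} [NormedAddCommGroup E] [NormedSpace ℝ E]
  {M : Type*} [TopologicalSpace M] [ChartedSpace E M] {k : ℕ}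

instance : AddCommGroup (FormField E M k) :=
  inferInstanceAs (AddCommGroup ((x : M) → TangentSpace 𝓘(ℝ, E) x [⋀^Fin k]→L[ℝ] ℝ))

instance : Module ℝ (FormField E M k) :=
  inferInstanceAs (Module ℝ ((x : M) → TangentSpace 𝓘(ℝ, E) x [⋀^Fin k]→L[ℝ] ℝ))

@[simp] theorem zero_apply (x : M) : (0 : FormField E M k) x = 0 := rfl

@[simp] theorem add_apply (α η : FormField E M k) (x : M) : (α + η) x = α x + η x := rfl

@[simp] theorem smul_apply (a : ℝ) (α : FormField E M k) (x : M) : (a • α) x = a • α x := rfl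

/-- The expression of a form in the preferred chart at `x₀`, i.e. its pullback under the inverse of
that chart. -/
def inChart (α : FormField E M k) (x₀ : M) : E → E [⋀^Fin k]→L[ℝ] ℝ := fun y =>
  (α ((extChartAt 𝓘(ℝ, E) x₀).symm y)).compContinuousLinearMap
    (mfderiv 𝓘(ℝ, E) 𝓘(ℝ, E) (extChartAt 𝓘(ℝ, E) x₀).symm y)

/-- The form is smooth on the open set `W`: its expressions in charts are smooth. -/
def SmoothOn (α : FormField E M k) (W : Set M) : Prop :=
  ∀ x₀ : M, ContDiffOn ℝ ∞ (α.inChart x₀)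
    ((extChartAt 𝓘(ℝ, E) x₀).target ∩ (extChartAt 𝓘(ℝ, E) x₀).symm ⁻¹' W)

/-- The de Rham differential, computed at each point in the preferred chart at that point. -/
def deRham (α : FormField E M k) : FormField E M (k + 1) := fun x =>
  (extDeriv (α.inChart x) (extChartAt 𝓘(ℝ, E) x x)).compContinuousLinearMap
    (mfderiv 𝓘(ℝ, E) 𝓘(ℝ, E) (extChartAt 𝓘(ℝ, E) x) x)

theorem inChart_add (α η : FormField E M k) (x₀ : M) :
    (α + η).inChart x₀ = α.inChart x₀ + η.inChart x₀ := rfl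

theorem inChart_smul (a : ℝ) (α : FormField E M k) (x₀ : M) :
    (a • α).inChart x₀ = a • α.inChart x₀ := rfl

theorem smoothOn_zero (W : Set M) : (0 : FormField E M k).SmoothOn W :=
  fun _ => contDiffOn_const (c := (0 : E [⋀^Fin k]→L[ℝ] ℝ))

theorem SmoothOn.add {α η : FormField E M k} {W : Set M} (hα : α.SmoothOn W)
    (hη : η.SmoothOn W) : (α + η).SmoothOn W :=
  fun x₀ => (hα x₀).add (hη x₀)

theorem SmoothOn.const_smul {α : FormField E M k} {W : Set M} (a : ℝ) (hα : α.SmoothOn W) :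
    (a • α).SmoothOn W :=
  fun x₀ => (hα x₀).const_smul a

theorem SmoothOn.differentiableAt {α : FormField E M k} {W : Set M} (hW : IsOpen W)
    (hα : α.SmoothOn W) {x : M} (hx : x ∈ W) :
    DifferentiableAt ℝ (α.inChart x) (extChartAt 𝓘(ℝ, E) x x) := by
  have ho : IsOpen ((extChartAt 𝓘(ℝ, E) x).target ∩ (extChartAt 𝓘(ℝ, E) x).symm ⁻¹' W) :=
    (continuousOn_extChartAt_symm x).isOpen_inter_preimage (isOpen_extChartAt_target x) hW
  refine ((hα x).contDiffAt (ho.mem_nhds ⟨mem_extChartAt_target x, ?_⟩)).differentiableAt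
    (by simp)
  simpa using hx

theorem deRham_add {α η : FormField E M k} {W : Set M} (hW : IsOpen W) (hα : α.SmoothOn W)
    (hη : η.SmoothOn W) {x : M} (hx : x ∈ W) :
    (α + η).deRham x = α.deRham x + η.deRham x := by
  unfold deRham
  rw [inChart_add, extDeriv_add (hα.differentiableAt hW hx) (hη.differentiableAt hW hx)]
  rfl

theorem deRham_smul (a : ℝ) (α : FormField E M k) (x : M) :
    (a • α).deRham x = a • α.deRham x := by
  unfold deRham
  rw [inChart_smul, extDeriv_smul]
  rfl

theorem deRham_zero (x : M) : (0 : FormField E M k).deRham x = 0 := by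
  have := deRham_smul (0 : ℝ) (0 : FormField E M k) x
  simpa using this

end FormField

/-- The wedge product `θ₁ ∧ … ∧ θ_k` of continuous linear forms:
`(θ₁ ∧ … ∧ θ_k) (v₁, …, v_k) = det (θ_a (v_b))`. -/
def wedgeOneForms {V : Type*} [AddCommGroup V] [Module ℝ V] [TopologicalSpace V] {k : ℕ}
    (θ : Fin k → V →L[ℝ] ℝ) : V [⋀^Fin k]→L[ℝ] ℝ :=
  ({ toMultilinearMap := (Matrix.detRowAlternating (n := Fin k) (R := ℝ)).toMultilinearMap
     cont := (continuous_id : Continuous fun A : Matrix (Fin k) (Fin k) ℝ => A).matrix_det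
     map_eq_zero_of_eq' :=
      (Matrix.detRowAlternating (n := Fin k) (R := ℝ)).map_eq_zero_of_eq' } :
    (Fin k → ℝ) [⋀^Fin k]→L[ℝ] ℝ).compContinuousLinearMap (ContinuousLinearMap.pi θ)

namespace Foliation

variable {E : Type*} [NormedAddCommGroup E] [NormedSpace ℝ E]
  {M : Type*} [TopologicalSpace M] [ChartedSpace E M] {p q : ℕ}

/-- The tangent space `T_x F` of the leaf through `x`: the kernel of the differential of the
transverse coordinates of a distinguished chart at `x` (all of them give the same kernel). -/
def tangent (F : Foliation E M p q) (x : M) : Submodule ℝ (TangentSpace 𝓘(ℝ, E) x) :=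
  ⨅ φ ∈ {φ | φ ∈ F.charts ∧ x ∈ φ.source},
    LinearMap.ker
      (mfderiv 𝓘(ℝ, E) 𝓘(ℝ, EuclideanSpace ℝ (Fin q)) (fun y => (φ y).2) x).toLinearMap

/-- `F.SameLeaf W x y`: the points `x` and `y` lie in the same leaf of the foliation induced by `F`
on the open set `W`, i.e. they are joined by a path in `W` along which the transverse coordinates
of distinguished charts are locally constant. -/
def SameLeaf (F : Foliation E M p q) (W : Set M) (x y : M) : Prop :=
  ∃ γ : Path x y, (∀ t, γ t ∈ W) ∧
    ∀ t, ∃ φ ∈ F.charts, γ t ∈ φ.source ∧ ∀ᶠ s in 𝓝 t, (φ (γ s)).2 = (φ (γ t)).2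

/-- Sections over the open set `W` of the sheaf `P⁰(F)`: smooth functions on `W` that are constant
along the leaves of the foliation induced on `W`.  A function on `W` is represented by its extension
by zero to `M`. -/
def projectable (F : Foliation E M p q) (W : Set M) : Submodule ℝ (M → ℝ) where
  carrier := {f | ContMDiffOn 𝓘(ℝ, E) 𝓘(ℝ, ℝ) ∞ f W ∧
    (∀ x y, F.SameLeaf W x y → f x = f y) ∧ ∀ x ∉ W, f x = 0}
  zero_mem' := ⟨contMDiffOn_const, fun _ _ _ => rfl, fun _ _ => rfl⟩
  add_mem' := fun {f g} hf hg => ⟨hf.1.add hg.1,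
    fun x y hxy => by simp [hf.2.1 x y hxy, hg.2.1 x y hxy],
    fun x hx => by simp [hf.2.2 x hx, hg.2.2 x hx]⟩
  smul_mem' := fun a f hf => ⟨((contDiff_const_smul a : ContDiff ℝ ∞ fun y : ℝ => a • y).contMDiff).comp_contMDiffOn hf.1,
    fun x y hxy => by simp [hf.2.1 x y hxy],
    fun x hx => by simp [hf.2.2 x hx]⟩

/-- The intersection `U_{i₀} ∩ … ∩ U_{i_k}`. -/
def _root_.cechInter {ι : Type*} (U : ι → Set M) {k : ℕ} (σ : Fin (k + 1) → ι) : Set M :=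
  ⋂ j, U (σ j)

/-- The Čech `k`-cochains of `P⁰(F)`: families `c_{i₀ … i_k}` of sections over
`U_{i₀} ∩ … ∩ U_{i_k}`. -/
def cechCochains (F : Foliation E M p q) {ι : Type*} (U : ι → Set M) (k : ℕ) :
    Submodule ℝ ((Fin (k + 1) → ι) → M → ℝ) :=
  Submodule.pi Set.univ fun σ => F.projectable (cechInter U σ)

/-- The Čech coboundary `(δc)_{i₀ … i_{k+1}} = ∑_j (-1)^j c_{i₀ … î_j … i_{k+1}}`, restricted to
`U_{i₀} ∩ … ∩ U_{i_{k+1}}`. -/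
def _root_.cechDelta {ι : Type*} (U : ι → Set M) (k : ℕ) :
    ((Fin (k + 1) → ι) → M → ℝ) →ₗ[ℝ] ((Fin (k + 2) → ι) → M → ℝ) where
  toFun c σ := (cechInter U σ).indicator
    (∑ j : Fin (k + 2), (-1 : ℝ) ^ (j : ℕ) • c (fun a => σ (j.succAbove a)))
  map_add' c d := by
    funext σ
    rw [Pi.add_apply, ← Set.indicator_add']
    simp [Finset.sum_add_distrib]
  map_smul' a c := by
    funext σ
    funext x
    by_cases hx : x ∈ cechInter U σ <;> simp [hx, Finset.mul_sum, mul_left_comm]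

/-- Čech cocycles. -/
def cechCocycles (F : Foliation E M p q) {ι : Type*} (U : ι → Set M) (k : ℕ) :
    Submodule ℝ ((Fin (k + 1) → ι) → M → ℝ) :=
  F.cechCochains U k ⊓ LinearMap.ker (cechDelta U k)

/-- Čech coboundaries. -/
def cechCoboundaries (F : Foliation E M p q) {ι : Type*} (U : ι → Set M) :
    (k : ℕ) → Submodule ℝ ((Fin (k + 1) → ι) → M → ℝ)
  | 0 => ⊥
  | k + 1 => (F.cechCochains U k).map (cechDelta U k)

/-- The Čech cohomology `Ȟ^k(U, P⁰(F))` of the covering `U`. -/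
abbrev CechCohomology (F : Foliation E M p q) {ι : Type*} (U : ι → Set M) (k : ℕ) : Type _ :=
  F.cechCocycles U k ⧸ (F.cechCoboundaries U k).submoduleOf (F.cechCocycles U k)

/-- A transversal distribution `νF`: a smooth distribution (locally spanned by smooth vector
fields) such that `TM = TF ⊕ νF`. -/
structure TransversalDistribution [IsManifold 𝓘(ℝ, E) ∞ M] (F : Foliation E M p q) where
  space : (x : M) → Submodule ℝ (TangentSpace 𝓘(ℝ, E) x)
  isCompl : ∀ x, IsCompl (F.tangent x) (space x)
  smooth : ∀ x : M, ∃ V ∈ 𝓝 x, ∃ X : Fin q → (y : M) → TangentSpace 𝓘(ℝ, E) y,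
    (∀ j, ContMDiffOn 𝓘(ℝ, E) (𝓘(ℝ, E).prod 𝓘(ℝ, E)) ∞
      (fun y => (⟨y, X j y⟩ : TangentBundle 𝓘(ℝ, E) M)) V) ∧
    ∀ y ∈ V, space y = Submodule.span ℝ (Set.range fun j => X j y)

namespace TransversalDistribution

variable [FiniteDimensional ℝ E] [IsManifold 𝓘(ℝ, E) ∞ M] {F : Foliation E M p q}

/-- The projection of `T_x M` onto `T_x F` along `ν_x F`. -/
def proj (ν : F.TransversalDistribution) (x : M) :
    TangentSpace 𝓘(ℝ, E) x →L[ℝ] TangentSpace 𝓘(ℝ, E) x where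
  toLinearMap := (F.tangent x).projection (ν.space x) (ν.isCompl x)
  cont := by
    let f : E →ₗ[ℝ] E := (F.tangent x).projection (ν.space x) (ν.isCompl x)
    exact f.continuous_of_finiteDimensional

/-- The leafwise differential `d''`: the component of type `(0, k + 1)` of the de Rham
differential. -/
def dLeaf (ν : F.TransversalDistribution) {k : ℕ} (α : FormField E M k) :
    FormField E M (k + 1) :=
  fun x => (α.deRham x).compContinuousLinearMap (ν.proj x)

/-- The 1-form `d''f` of a function `f`: the component of type `(0, 1)` of `df`. -/
def dLeafFun (ν : F.TransversalDistribution) (f : M → ℝ) (x : M) :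
    TangentSpace 𝓘(ℝ, E) x →L[ℝ] ℝ :=
  (mfderiv 𝓘(ℝ, E) 𝓘(ℝ, ℝ) f x).comp (ν.proj x)

theorem dLeaf_add (ν : F.TransversalDistribution) {k : ℕ} {α η : FormField E M k} {W : Set M}
    (hW : IsOpen W) (hα : α.SmoothOn W) (hη : η.SmoothOn W) {x : M} (hx : x ∈ W) :
    ν.dLeaf (α + η) x = ν.dLeaf α x + ν.dLeaf η x := by
  unfold dLeaf
  rw [FormField.deRham_add hW hα hη hx]
  rfl

theorem dLeaf_smul (ν : F.TransversalDistribution) {k : ℕ} (a : ℝ) (α : FormField E M k) (x : M) :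
    ν.dLeaf (a • α) x = a • ν.dLeaf α x := by
  unfold dLeaf
  rw [FormField.deRham_smul]
  rfl

theorem dLeaf_zero (ν : F.TransversalDistribution) {k : ℕ} (x : M) :
    ν.dLeaf (0 : FormField E M k) x = 0 := by
  unfold dLeaf
  rw [FormField.deRham_zero]
  rfl

open TopologicalSpace (Opens)

/-- `Ω_{0,k}(W)`: the smooth `k`-forms of type `(0, k)` on the open set `W`, i.e. those vanishing as
soon as one argument is in `νF`.  A form on `W` is represented by its extension by zero to `M`. -/
def leafwiseForms (ν : F.TransversalDistribution) (W : Opens M) (k : ℕ) :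
    Submodule ℝ (FormField E M k) where
  carrier := {α | α.SmoothOn W ∧ (∀ x v, (∃ j, v j ∈ ν.space x) → α x v = 0) ∧
    ∀ x ∉ W, α x = 0}
  zero_mem' := ⟨FormField.smoothOn_zero _, fun _ _ _ => rfl, fun _ _ => rfl⟩
  add_mem' := fun {α η} hα hη => ⟨hα.1.add hη.1,
    fun x v hv => by simp [hα.2.1 x v hv, hη.2.1 x v hv],
    fun x hx => by simp [hα.2.2 x hx, hη.2.2 x hx]⟩
  smul_mem' := fun a α hα => ⟨hα.1.const_smul a,
    fun x v hv => by simp [hα.2.1 x v hv],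
    fun x hx => by simp [hα.2.2 x hx]⟩

/-- The kernel of `d'' : Ω_{0,k}(W) → Ω_{0,k+1}(W)`. -/
def closedForms (ν : F.TransversalDistribution) (W : Opens M) (k : ℕ) :
    Submodule ℝ (FormField E M k) where
  carrier := {α | α ∈ ν.leafwiseForms W k ∧ ∀ x ∈ W, ν.dLeaf α x = 0}
  zero_mem' := ⟨zero_mem _, fun x _ => ν.dLeaf_zero x⟩
  add_mem' := fun {α η} hα hη => ⟨add_mem hα.1 hη.1, fun x hx => by
    rw [ν.dLeaf_add W.isOpen hα.1.1 hη.1.1 hx, hα.2 x hx, hη.2 x hx, add_zero]⟩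
  smul_mem' := fun a α hα => ⟨Submodule.smul_mem _ a hα.1, fun x hx => by
    rw [ν.dLeaf_smul, hα.2 x hx, smul_zero]⟩

/-- The image of `d'' : Ω_{0,k-1}(W) → Ω_{0,k}(W)`, which is zero for `k = 0`. -/
def exactForms (ν : F.TransversalDistribution) (W : Opens M) :
    (k : ℕ) → Submodule ℝ (FormField E M k)
  | 0 => ⊥
  | k + 1 =>
    { carrier := {α | α ∈ ν.leafwiseForms W (k + 1) ∧
        ∃ η ∈ ν.leafwiseForms W k, ∀ x ∈ W, ν.dLeaf η x = α x}
      zero_mem' := ⟨zero_mem _, 0, zero_mem _, fun x _ => ν.dLeaf_zero x⟩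
      add_mem' := by
        rintro α₁ α₂ ⟨h₁, η₁, hη₁, e₁⟩ ⟨h₂, η₂, hη₂, e₂⟩
        refine ⟨add_mem h₁ h₂, η₁ + η₂, add_mem hη₁ hη₂, fun x hx => ?_⟩
        rw [ν.dLeaf_add W.isOpen hη₁.1 hη₂.1 hx, e₁ x hx, e₂ x hx, FormField.add_apply]
      smul_mem' := by
        rintro a α ⟨h, η, hη, e⟩
        refine ⟨Submodule.smul_mem _ a h, a • η, Submodule.smul_mem _ a hη, fun x hx => ?_⟩
        rw [ν.dLeaf_smul, e x hx, FormField.smul_apply] }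

/-- The leafwise de Rham cohomology `H^k(W, P⁰(F|_W))` of the open set `W`. -/
abbrev LeafwiseCohomology (ν : F.TransversalDistribution) (W : Opens M) (k : ℕ) : Type _ :=
  ν.closedForms W k ⧸ (ν.exactForms W k).submoduleOf (ν.closedForms W k)

/-- A good covering: a locally finite open covering such that the leafwise cohomology of all
non-empty finite intersections `U_{i₀} ∩ … ∩ U_{i_m}` vanishes in positive degrees. -/
structure IsGoodCovering (ν : F.TransversalDistribution) {ι : Type*} (U : ι → Set M) : Prop where
  isOpen : ∀ i, IsOpen (U i)
  covers : ⋃ i, U i = Set.univ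
  locallyFinite : LocallyFinite U
  acyclic : ∀ (m : ℕ) (σ : Fin (m + 1) → ι) (k : ℕ), 0 < k →
    Subsingleton (ν.LeafwiseCohomology
      ⟨cechInter U σ, isOpen_iInter_of_finite fun j => isOpen (σ j)⟩ k)

/-- The form `(-1)^{k(k+1)/2} ∑_{i₁,…,i_k} c_{i₁ … i_k i} d''h_{i₁} ∧ … ∧ d''h_{i_k}`
(only finitely many terms are non-zero at each point when the covering is locally finite). -/
def cechForm (ν : F.TransversalDistribution) {ι : Type*} (h : ι → M → ℝ) {k : ℕ}
    (c : (Fin (k + 1) → ι) → M → ℝ) (i : ι) : FormField E M k := fun x =>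
  (-1 : ℝ) ^ (k * (k + 1) / 2) • ∑ᶠ σ : Fin k → ι,
    c (Fin.snoc (α := fun _ => ι) σ i) x • wedgeOneForms fun a => ν.dLeafFun (h (σ a)) x

end TransversalDistribution

end Foliation

end

/-! Both cohomologies are compared inside the Čech–de Rham double complex of Čech `a`-cochains with
values in leafwise `b`-forms, with vertical differential `d''` and horizontal differential `δ`,
which commute. The rows are exact because forms can be multiplied by the partition of unity
(`cochainδ_cochainK`), the columns because the covering is good (`exists_cochainD_eq`). The kernel
of `d''` in form degree 0 is the Čech complex of `P⁰` (`cochainFun_mem_iff`, resting on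
`mem_projectable_iff`). The kernel of `δ` in Čech degree 0 consists of the restrictions of global
forms (`resGlobal_glue`).

A zigzag replaces `δ θ` by `d'' θ` repeatedly and so leads from bidegree `(k, 0)` to `(0, k)`. No
total complex is needed: the single predicate `IsDoubleBoundary`, available in every bidegree, is
preserved in both directions along a zigzag (`Zigzag.isDoubleBoundary_iff`). It means "Čech
coboundary" at one end and "exact form" at the other, which gives well-definedness and injectivity
together. Surjectivity comes from running a zigzag backwards with exact columns
(`Zigzag.exists_left`).

The explicit formula arises from choosing `θ` by the partition-of-unity homotopy. Each step
multiplies by some `h i`. Since the coefficients are constant along the leaves, `d''` differentiates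
only `h i`, and moving `d''h i` behind the `b` factors already present costs `(-1)^b`
(`cochainD_cochainK_apply`). These signs multiply to `(-1)^(k(k-1)/2)`; a last factor `(-1)^k`,
harmless for cohomology, gives the stated normalisation.

The geometric input is that `d''` depends only on restrictions to leaves: in a distinguished chart
the leaf directions form a constant subspace, so the de Rham differential preserves forms vanishing
on them (`val_deRham_apply_eq_zero`). Thus `d'' ∘ d'' = 0` and the formula for `d''(f d''g₁ ∧ … ∧
d''g_k)` reduce to their de Rham counterparts. -/

noncomputable section

/-! ### Alternating maps and exterior derivatives on normed spaces -/

section Calculus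

variable {X V V' : Type*} [NormedAddCommGroup X] [NormedSpace ℝ X]
  [NormedAddCommGroup V] [NormedSpace ℝ V] [NormedAddCommGroup V'] [NormedSpace ℝ V'] {k : ℕ}

/-- Evaluation of a smooth family of alternating maps on smooth vectors is smooth. -/
theorem ContDiffAt.alternatingMap_apply {n : WithTop ℕ∞} {f : X → V [⋀^Fin k]→L[ℝ] ℝ}
    {v : Fin k → X → V} {x : X} (hf : ContDiffAt ℝ n f x) (hv : ∀ i, ContDiffAt ℝ n (v i) x) :
    ContDiffAt ℝ n (fun y => f y (fun i => v i y)) x := by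
  have h := (ContinuousLinearMap.analyticAt_uncurry_of_multilinear
    (ContinuousAlternatingMap.toContinuousMultilinearMapCLM ℝ :
      (V [⋀^Fin k]→L[ℝ] ℝ) →L[ℝ] _) (x := (f x, fun i => v i x)))
  exact h.contDiffAt.comp x (f := fun y => (f y, fun i => v i y)) (hf.prodMk (contDiffAt_pi.2 hv))

/-- On a finite-dimensional space, a family of alternating maps is smooth as soon as all its
evaluations are. -/
theorem contDiffAt_alternatingMap_of_apply [FiniteDimensional ℝ V] {n : WithTop ℕ∞}
    {f : X → V [⋀^Fin k]→L[ℝ] ℝ} {x : X}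
    (hf : ∀ v : Fin k → V, ContDiffAt ℝ n (fun y => f y v) x) : ContDiffAt ℝ n f x := by
  let b := Module.finBasis ℝ V
  let ev : (V [⋀^Fin k]→L[ℝ] ℝ) →ₗ[ℝ] ((Fin k → Fin (Module.finrank ℝ V)) → ℝ) :=
    { toFun := fun g s => g fun i => b (s i)
      map_add' := fun _ _ => rfl
      map_smul' := fun _ _ => rfl }
  -- Evaluation on tuples of basis vectors embeds the alternating maps into a finite power of `ℝ`,
  -- so a linear left inverse recovers `f` smoothly from its evaluations.
  have hinj : LinearMap.ker ev = ⊥ := by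
    rw [LinearMap.ker_eq_bot]
    intro g g' hg
    apply ContinuousAlternatingMap.toAlternatingMap_injective
    refine Module.Basis.ext_alternating b fun s _ => ?_
    exact congrFun hg s
  obtain ⟨l, hl⟩ := ev.exists_leftInverse_of_injective hinj
  have : f = fun y => LinearMap.toContinuousLinearMap l (ev (f y)) := by
    funext y
    exact (LinearMap.congr_fun hl (f y)).symm
  rw [this]
  exact (ContinuousLinearMap.contDiff _).contDiffAt.comp x (contDiffAt_pi.2 fun s => hf _)

theorem ContDiffAt.alternatingMap_comp [FiniteDimensional ℝ V] {n : WithTop ℕ∞}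
    {f : X → V' [⋀^Fin k]→L[ℝ] ℝ} {L : X → V →L[ℝ] V'} {x : X} (hf : ContDiffAt ℝ n f x)
    (hL : ContDiffAt ℝ n L x) :
    ContDiffAt ℝ n (fun y => (f y).compContinuousLinearMap (L y)) x :=
  contDiffAt_alternatingMap_of_apply fun _ =>
    hf.alternatingMap_apply fun _ => hL.clm_apply contDiffAt_const

theorem ContDiffAt.extDeriv {f : V → V [⋀^Fin k]→L[ℝ] ℝ} {x : V} (hf : ContDiffAt ℝ ∞ f x) :
    ContDiffAt ℝ ∞ (extDeriv f) x :=
  ContDiffAt.comp x (g := ContinuousAlternatingMap.alternatizeUncurryFinCLM ℝ V ℝ)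
    (ContinuousLinearMap.contDiff _).contDiffAt (hf.fderiv_right (m := ∞) (by simp))

/-- If a form vanishes on the vectors of a fixed subspace, so does its differential. -/
theorem extDeriv_apply_eq_zero {f : V → V [⋀^Fin k]→L[ℝ] ℝ} {x : V} (hf : DifferentiableAt ℝ f x)
    (L : Submodule ℝ V) (hL : ∀ᶠ y in 𝓝 x, ∀ v : Fin k → V, (∀ i, v i ∈ L) → f y v = 0)
    {v : Fin (k + 1) → V} (hv : ∀ i, v i ∈ L) : extDeriv f x v = 0 := by
  -- The differential is an alternating sum of derivatives of evaluations of `f` at fixed vectors of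
  -- `L`, and each such evaluation vanishes near `x`.
  rw [extDeriv_apply hf]
  refine Finset.sum_eq_zero fun i _ => ?_
  have : (fun y => f y (i.removeNth v)) =ᶠ[𝓝 x] fun _ => 0 :=
    hL.mono fun y hy => hy _ fun j => hv _
  rw [this.fderiv_eq]
  simp

theorem wedgeOneForms_apply {V : Type*} [AddCommGroup V] [Module ℝ V] [TopologicalSpace V] {k : ℕ}
    (θ : Fin k → V →L[ℝ] ℝ) (v : Fin k → V) :
    wedgeOneForms θ v = Matrix.det (Matrix.of fun a b => θ b (v a)) := rfl

theorem contDiffAt_wedgeOneForms [FiniteDimensional ℝ V] {θ : Fin k → X → V →L[ℝ] ℝ} {x : X}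
    (hθ : ∀ a, ContDiffAt ℝ ∞ (θ a) x) :
    ContDiffAt ℝ ∞ (fun y => wedgeOneForms fun a => θ a y) x := by
  refine contDiffAt_alternatingMap_of_apply fun v => ?_
  simp only [wedgeOneForms_apply, Matrix.det_apply]
  refine ContDiffAt.sum fun σ _ => ContDiffAt.const_smul _ ?_
  refine contDiffAt_prod fun i _ => ?_
  exact (hθ i).clm_apply contDiffAt_const

theorem minSmoothness_two_le_infty : minSmoothness ℝ 2 ≤ (∞ : WithTop ℕ∞) := by
  rw [minSmoothness_of_isRCLikeNormedField]
  exact WithTop.coe_le_coe.2 le_top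

/-- `d (f dg₁ ∧ … ∧ dg_k) = df ∧ dg₁ ∧ … ∧ dg_k`. -/
theorem extDeriv_smul_wedgeOneForms_fderiv {f : V → ℝ} {g : Fin k → V → ℝ} {x : V}
    (hf : ContDiffAt ℝ ∞ f x) (hg : ∀ a, ContDiffAt ℝ ∞ (g a) x) :
    extDeriv (fun y => f y • wedgeOneForms fun a => fderiv ℝ (g a) y) x =
      wedgeOneForms (Fin.cons (fderiv ℝ f x) fun a => fderiv ℝ (g a) x :
        Fin (k + 1) → V →L[ℝ] ℝ) := by
  -- With `G = (f, g₁, …, g_k)`, the form is the pullback under `G` of `z₀ dz₁ ∧ … ∧ dz_k` on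
  -- `ℝ^(k+1)`, and exterior differentiation commutes with pullback.
  let G : V → (Fin (k + 1) → ℝ) := fun y => (Fin.cons (f y) fun a => g a y : Fin (k + 1) → ℝ)
  have hG : ContDiffAt ℝ ∞ G x := by
    refine contDiffAt_pi.2 fun i => ?_
    refine Fin.cases ?_ (fun a => ?_) i
    · exact hf
    · exact hg a
  let κ₀ : (Fin (k + 1) → ℝ) [⋀^Fin k]→L[ℝ] ℝ :=
    wedgeOneForms fun a : Fin k => ContinuousLinearMap.proj a.succ
  let κ : (Fin (k + 1) → ℝ) → (Fin (k + 1) → ℝ) [⋀^Fin k]→L[ℝ] ℝ := fun z => z 0 • κ₀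
  have hκ : DifferentiableAt ℝ κ (G x) := by
    have : Differentiable ℝ κ := (by fun_prop : Differentiable ℝ fun z : Fin (k + 1) → ℝ => z 0).smul_const κ₀
    exact this _
  have hev : (fun y => f y • wedgeOneForms fun a => fderiv ℝ (g a) y) =ᶠ[𝓝 x]
      fun y => (κ (G y)).compContinuousLinearMap (fderiv ℝ G y) := by
    have h1 : ∀ᶠ y in 𝓝 x, DifferentiableAt ℝ G y :=
      ((hG.of_le (m := 1) (by simp)).eventually (by simp)).mono fun y hy =>
        hy.differentiableAt (by simp)
    filter_upwards [h1] with y hy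
    ext v
    change f y * _ = f y * _
    congr 1
    change Matrix.det (Matrix.of fun a b => fderiv ℝ (g b) y (v a)) = Matrix.det (Matrix.of fun a b => fderiv ℝ G y (v a) (Fin.succ b))
    congr 1
    ext a b
    simp only [Matrix.of_apply]
    have h2 : HasFDerivAt (fun y => G y b.succ) _ y :=
      (hasFDerivAt_pi'.1 hy.hasFDerivAt) b.succ
    have h3 : (fun y => G y b.succ) = g b := by
      funext z; simp [G]
    rw [h3] at h2
    rw [h2.fderiv]
    rfl
  rw [hev.extDeriv_eq, extDeriv_pullback hκ hG minSmoothness_two_le_infty]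
  ext v
  rw [wedgeOneForms_apply]
  -- The formula for the exterior derivative of `κ` matches, term by term, the Laplace expansion of
  -- the determinant along the column of `df`.
  rw [ContinuousAlternatingMap.compContinuousLinearMap_apply, extDeriv_apply hκ,
    Matrix.det_succ_column_zero]
  have hGd := hG.differentiableAt (by simp)
  have h4 : ∀ i u, fderiv ℝ G x u i = (Fin.cons (fderiv ℝ f x) fun a => fderiv ℝ (g a) x :
        Fin (k + 1) → V →L[ℝ] ℝ) i u := by
    intro i u
    have h2 : HasFDerivAt (fun y => G y i) _ x :=
      (hasFDerivAt_pi'.1 hGd.hasFDerivAt) i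
    refine Fin.cases ?_ (fun a => ?_) i
    · have h2 : HasFDerivAt (fun y => G y 0) _ x :=
        (hasFDerivAt_pi'.1 hGd.hasFDerivAt) 0
      have h3 : (fun y => G y 0) = f := rfl
      rw [h3] at h2
      rw [Fin.cons_zero, h2.fderiv]
      rfl
    · have h2 : HasFDerivAt (fun y => G y a.succ) _ x :=
        (hasFDerivAt_pi'.1 hGd.hasFDerivAt) a.succ
      have h3 : (fun y => G y a.succ) = g a := rfl
      rw [h3] at h2
      rw [Fin.cons_succ, h2.fderiv]
      rfl
  refine Finset.sum_congr rfl fun i _ => ?_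
  have h5 : fderiv ℝ (fun z => κ z (i.removeNth (⇑(fderiv ℝ G x) ∘ v))) (G x)
      = (κ₀ (i.removeNth (⇑(fderiv ℝ G x) ∘ v))) •
        (ContinuousLinearMap.proj 0 : (Fin (k + 1) → ℝ) →L[ℝ] ℝ) := by
    have : HasFDerivAt (fun z : Fin (k + 1) → ℝ => z 0 * κ₀ (i.removeNth (⇑(fderiv ℝ G x) ∘ v)))
      ((κ₀ (i.removeNth (⇑(fderiv ℝ G x) ∘ v))) •
        (ContinuousLinearMap.proj 0 : (Fin (k + 1) → ℝ) →L[ℝ] ℝ)) (G x) :=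
      HasFDerivAt.mul_const (ContinuousLinearMap.proj 0 : (Fin (k + 1) → ℝ) →L[ℝ] ℝ).hasFDerivAt _
    exact this.fderiv
  rw [h5]
  simp only [smul_apply, ContinuousLinearMap.proj_apply, Function.comp_apply,
    smul_eq_mul, h4, Fin.cons_zero, Matrix.of_apply]
  have h6 : κ₀ (i.removeNth (⇑(fderiv ℝ G x) ∘ v)) =
      Matrix.det ((Matrix.of fun a b => (Fin.cons (fderiv ℝ f x) fun a => fderiv ℝ (g a) x :
        Fin (k + 1) → V →L[ℝ] ℝ) b (v a)).submatrix i.succAbove Fin.succ) := by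
    change Matrix.det _ = _
    congr 1
    ext a b
    exact h4 _ _
  rw [h6]
  ring

end Calculus

/-! ### Forms and the de Rham differential in arbitrary smooth charts -/

section Charts

variable {E : Type*} [NormedAddCommGroup E] [NormedSpace ℝ E]
  {M : Type*} [TopologicalSpace M] [ChartedSpace E M]
  {V V' : Type*} [NormedAddCommGroup V] [NormedSpace ℝ V]
  [NormedAddCommGroup V'] [NormedSpace ℝ V'] {k : ℕ}

/-- A chart with values in a normed space that belongs to the smooth structure of `M`. -/
structure IsSmoothChart (φ : OpenPartialHomeomorph M V) : Prop where
  smooth : ContMDiffOn 𝓘(ℝ, E) 𝓘(ℝ, V) ∞ φ φ.source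
  smooth_symm : ContMDiffOn 𝓘(ℝ, V) 𝓘(ℝ, E) ∞ φ.symm φ.target

theorem isSmoothChart_chartAt [IsManifold 𝓘(ℝ, E) ∞ M] (x : M) :
    IsSmoothChart (E := E) (chartAt E x) :=
  ⟨contMDiffOn_chart, contMDiffOn_chart_symm⟩

namespace IsSmoothChart

variable {φ : OpenPartialHomeomorph M V} {ψ : OpenPartialHomeomorph M V'}

theorem mdifferentiable (hφ : IsSmoothChart (E := E) φ) :
    φ.MDifferentiable 𝓘(ℝ, E) 𝓘(ℝ, V) :=
  ⟨hφ.smooth.mdifferentiableOn (by simp), hφ.smooth_symm.mdifferentiableOn (by simp)⟩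

/-- The derivative of the chart as a map between the model spaces. -/
def _root_.chartDeriv (E : Type*) [NormedAddCommGroup E] [NormedSpace ℝ E]
    {M : Type*} [TopologicalSpace M] [ChartedSpace E M]
    {V : Type*} [NormedAddCommGroup V] [NormedSpace ℝ V]
    (φ : OpenPartialHomeomorph M V) (x : M) : E →L[ℝ] V :=
  mfderiv 𝓘(ℝ, E) 𝓘(ℝ, V) φ x

/-- The derivative of the inverse of the chart as a map between the model spaces. -/
def _root_.chartSymmDeriv (E : Type*) [NormedAddCommGroup E] [NormedSpace ℝ E]
    {M : Type*} [TopologicalSpace M] [ChartedSpace E M]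
    {V : Type*} [NormedAddCommGroup V] [NormedSpace ℝ V]
    (φ : OpenPartialHomeomorph M V) (y : V) : V →L[ℝ] E :=
  mfderiv 𝓘(ℝ, V) 𝓘(ℝ, E) φ.symm y

theorem symm_comp_deriv (hφ : IsSmoothChart (E := E) φ) {x : M} (hx : x ∈ φ.source) :
    (chartSymmDeriv E φ (φ x)).comp (chartDeriv E φ x) = ContinuousLinearMap.id ℝ E :=
  hφ.mdifferentiable.symm_comp_deriv hx

theorem comp_symm_deriv (hφ : IsSmoothChart (E := E) φ) {y : V} (hy : y ∈ φ.target) :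
    (chartDeriv E φ (φ.symm y)).comp (chartSymmDeriv E φ y) = ContinuousLinearMap.id ℝ V :=
  hφ.mdifferentiable.comp_symm_deriv hy

theorem symm_deriv_apply (hφ : IsSmoothChart (E := E) φ) {x : M} (hx : x ∈ φ.source) (v : E) :
    chartSymmDeriv E φ (φ x) (chartDeriv E φ x v) = v :=
  DFunLike.congr_fun (hφ.symm_comp_deriv hx) v

/-- The transition map between two smooth charts is smooth. -/
theorem contDiffAt_transition [IsManifold 𝓘(ℝ, E) ∞ M] (hφ : IsSmoothChart (E := E) φ)
    (hψ : IsSmoothChart (E := E) ψ) {x : M} (hx : x ∈ φ.source) (hx' : x ∈ ψ.source) :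
    ContDiffAt ℝ ∞ (ψ ∘ φ.symm) (φ x) := by
  rw [← contMDiffAt_iff_contDiffAt]
  refine ContMDiffAt.comp (I' := 𝓘(ℝ, E)) (φ x) ?_ ?_
  · rw [φ.left_inv hx]
    exact hψ.smooth.contMDiffAt (ψ.open_source.mem_nhds hx')
  · exact hφ.smooth_symm.contMDiffAt (φ.open_target.mem_nhds (φ.map_source hx))

theorem fderiv_transition (hφ : IsSmoothChart (E := E) φ)
    (hψ : IsSmoothChart (E := E) ψ) {x : M} (hx : x ∈ φ.source) (hx' : x ∈ ψ.source) :
    fderiv ℝ (ψ ∘ φ.symm) (φ x) = (chartDeriv E ψ x).comp (chartSymmDeriv E φ (φ x)) := by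
  rw [← mfderiv_eq_fderiv]
  have h1 : MDifferentiableAt 𝓘(ℝ, V) 𝓘(ℝ, E) φ.symm (φ x) :=
    hφ.mdifferentiable.mdifferentiableAt_symm (φ.map_source hx)
  have h2 : MDifferentiableAt 𝓘(ℝ, E) 𝓘(ℝ, V') ψ (φ.symm (φ x)) := by
    rw [φ.left_inv hx]
    exact hψ.mdifferentiable.mdifferentiableAt hx'
  have := mfderiv_comp (φ x) h2 h1
  refine this.trans ?_
  change (chartDeriv E ψ (φ.symm (φ x))).comp (chartSymmDeriv E φ (φ x)) = _
  rw [φ.left_inv hx]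

end IsSmoothChart

namespace FormField

/-- The value of a form at a point as an alternating map on the model space. -/
def val (α : FormField E M k) (x : M) : E [⋀^Fin k]→L[ℝ] ℝ := α x

/-- The expression of a form in a chart. -/
def coord (φ : OpenPartialHomeomorph M V) (α : FormField E M k) (y : V) : V [⋀^Fin k]→L[ℝ] ℝ :=
  (α.val (φ.symm y)).compContinuousLinearMap (chartSymmDeriv E φ y)

theorem coord_chartAt (α : FormField E M k) (x : M) : α.coord (chartAt E x) = α.inChart x := by
  funext y
  simp only [coord, inChart, val, chartSymmDeriv, mfld_simps]
  rfl

theorem coord_apply_chart {φ : OpenPartialHomeomorph M V} (α : FormField E M k) {x : M}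
    (hx : x ∈ φ.source) :
    α.coord φ (φ x) = (α.val x).compContinuousLinearMap (chartSymmDeriv E φ (φ x)) := by
  rw [coord, φ.left_inv hx]

theorem val_eq_coord {φ : OpenPartialHomeomorph M V} (hφ : IsSmoothChart (E := E) φ)
    (α : FormField E M k) {x : M} (hx : x ∈ φ.source) :
    α.val x = (α.coord φ (φ x)).compContinuousLinearMap (chartDeriv E φ x) := by
  rw [coord_apply_chart _ hx]
  ext v
  simp only [ContinuousAlternatingMap.compContinuousLinearMap_apply]
  congr 1
  funext i
  exact (hφ.symm_deriv_apply hx _).symm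

/-- Change of charts. -/
theorem coord_eq_pullback {φ : OpenPartialHomeomorph M V} {ψ : OpenPartialHomeomorph M V'}
    (hφ : IsSmoothChart (E := E) φ) (hψ : IsSmoothChart (E := E) ψ) (α : FormField E M k) {x : M}
    (hx : x ∈ φ.source) (hx' : x ∈ ψ.source) :
    α.coord φ (φ x) = (α.coord ψ ((ψ ∘ φ.symm) (φ x))).compContinuousLinearMap
      (fderiv ℝ (ψ ∘ φ.symm) (φ x)) := by
  rw [hφ.fderiv_transition hψ hx hx', Function.comp_apply, φ.left_inv hx, coord_apply_chart _ hx,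
    val_eq_coord hψ _ hx']
  rfl

/-- The change of charts as an identity of germs, which is what differentiation requires. -/
theorem eventually_coord_eq_pullback {φ : OpenPartialHomeomorph M V}
    {ψ : OpenPartialHomeomorph M V'}
    (hφ : IsSmoothChart (E := E) φ) (hψ : IsSmoothChart (E := E) ψ) (α : FormField E M k) {x : M}
    (hx : x ∈ φ.source) (hx' : x ∈ ψ.source) :
    α.coord φ =ᶠ[𝓝 (φ x)] fun y => (α.coord ψ ((ψ ∘ φ.symm) y)).compContinuousLinearMap
      (fderiv ℝ (ψ ∘ φ.symm) y) := by
  have h : (φ.symm.trans ψ).source ∈ 𝓝 (φ x) := by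
    refine (φ.symm.trans ψ).open_source.mem_nhds ?_
    simp [hx, hx']
  filter_upwards [h] with y hy
  rw [OpenPartialHomeomorph.trans_source] at hy
  have := coord_eq_pullback hφ hψ α (φ.map_target hy.1) hy.2
  rwa [φ.right_inv hy.1] at this

variable [FiniteDimensional ℝ E] [FiniteDimensional ℝ V] [IsManifold 𝓘(ℝ, E) ∞ M]

/-- The form is smooth at the point `x`. -/
def SmoothAt (α : FormField E M k) (x : M) : Prop :=
  ContDiffAt ℝ ∞ (α.coord (chartAt E x)) (chartAt E x x)

omit [FiniteDimensional ℝ E] in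
theorem contDiffAt_coord_of_contDiffAt_coord
    {φ : OpenPartialHomeomorph M V} {ψ : OpenPartialHomeomorph M V'}
    (hφ : IsSmoothChart (E := E) φ) (hψ : IsSmoothChart (E := E) ψ) {α : FormField E M k} {x : M}
    (hx : x ∈ φ.source) (hx' : x ∈ ψ.source) (h : ContDiffAt ℝ ∞ (α.coord ψ) (ψ x)) :
    ContDiffAt ℝ ∞ (α.coord φ) (φ x) := by
  refine ContDiffAt.congr_of_eventuallyEq ?_ (eventually_coord_eq_pullback hφ hψ α hx hx')
  have hT := hφ.contDiffAt_transition hψ hx hx'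
  refine ContDiffAt.alternatingMap_comp
    (ContDiffAt.comp (g := α.coord ψ) (f := ψ ∘ φ.symm) (φ x) ?_ hT) (hT.fderiv_right (m := ∞) (by simp))
  rwa [Function.comp_apply, φ.left_inv hx]

theorem smoothAt_iff_coord {φ : OpenPartialHomeomorph M V}
    (hφ : IsSmoothChart (E := E) φ) {α : FormField E M k} {x : M} (hx : x ∈ φ.source) :
    α.SmoothAt x ↔ ContDiffAt ℝ ∞ (α.coord φ) (φ x) :=
  ⟨contDiffAt_coord_of_contDiffAt_coord hφ (isSmoothChart_chartAt x) hx (mem_chart_source E x),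
   contDiffAt_coord_of_contDiffAt_coord (isSmoothChart_chartAt x) hφ (mem_chart_source E x) hx⟩

/-- Smoothness does not depend on the chart, so the condition in all preferred charts reduces to one
germ condition at each point, which can then be tested in distinguished charts. -/
theorem smoothOn_iff_smoothAt {α : FormField E M k} {W : Set M} (hW : IsOpen W) :
    α.SmoothOn W ↔ ∀ x ∈ W, α.SmoothAt x := by
  have ho (x : M) : IsOpen ((extChartAt 𝓘(ℝ, E) x).target ∩ (extChartAt 𝓘(ℝ, E) x).symm ⁻¹' W) :=
    (continuousOn_extChartAt_symm x).isOpen_inter_preimage (isOpen_extChartAt_target x) hW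
  constructor
  · intro h x hx
    have h1 := (h x).contDiffAt ((ho x).mem_nhds ⟨mem_extChartAt_target x, by simpa using hx⟩)
    rw [← coord_chartAt] at h1
    simp only [mfld_simps] at h1
    exact h1
  · intro h x₀ y hy
    have hy1 : y ∈ (chartAt E x₀).target := by simpa only [mfld_simps] using hy.1
    have hy2 : (chartAt E x₀).symm y ∈ W := by simpa only [mfld_simps] using hy.2
    have h1 := (smoothAt_iff_coord (isSmoothChart_chartAt x₀)
      ((chartAt E x₀).map_target hy1)).1 (h _ hy2)
    rw [(chartAt E x₀).right_inv hy1, coord_chartAt] at h1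
    exact h1.contDiffWithinAt

omit [FiniteDimensional ℝ E] [FiniteDimensional ℝ V] [IsManifold 𝓘(ℝ, E) ∞ M] in
theorem eventuallyEq_coord {φ : OpenPartialHomeomorph M V} {α η : FormField E M k} {x : M}
    (hx : x ∈ φ.source) (h : ∀ᶠ y in 𝓝 x, α y = η y) : α.coord φ =ᶠ[𝓝 (φ x)] η.coord φ := by
  have h1 : ContinuousAt φ.symm (φ x) := φ.continuousAt_symm (φ.map_source hx)
  rw [ContinuousAt, φ.left_inv hx] at h1
  filter_upwards [h1.eventually h] with y hy
  simp only [coord, val, hy]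

omit [FiniteDimensional ℝ E] [IsManifold 𝓘(ℝ, E) ∞ M] in
theorem SmoothAt.congr {α η : FormField E M k} {x : M}
    (hα : α.SmoothAt x) (h : ∀ᶠ y in 𝓝 x, η y = α y) : η.SmoothAt x :=
  ContDiffAt.congr_of_eventuallyEq hα (eventuallyEq_coord (mem_chart_source E x) h)

omit [FiniteDimensional ℝ E] [IsManifold 𝓘(ℝ, E) ∞ M] in
theorem deRham_congr {α η : FormField E M k} {x : M} (h : ∀ᶠ y in 𝓝 x, η y = α y) :
    η.deRham x = α.deRham x := by
  unfold deRham
  have := eventuallyEq_coord (mem_chart_source E x) h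
  rw [coord_chartAt, coord_chartAt] at this
  have h2 : extDeriv (η.inChart x) (extChartAt 𝓘(ℝ, E) x x) =
      extDeriv (α.inChart x) (extChartAt 𝓘(ℝ, E) x x) := by
    apply Filter.EventuallyEq.extDeriv_eq
    simpa only [mfld_simps] using this
  rw [h2]

omit [FiniteDimensional ℝ E] [FiniteDimensional ℝ V] in
-- `deRham` is computed in a preferred chart that changes from point to point. Naturality of the
-- exterior derivative under the transition maps shows that any smooth chart may be used instead.
theorem coord_deRham {φ : OpenPartialHomeomorph M V}
    (hφ : IsSmoothChart (E := E) φ) {α : FormField E M k} {x : M} (hx : x ∈ φ.source)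
    (hα : α.SmoothAt x) : α.deRham.coord φ (φ x) = extDeriv (α.coord φ) (φ x) := by
  have hc := isSmoothChart_chartAt (E := E) x
  have hxc := mem_chart_source E x
  have hT := hφ.contDiffAt_transition hc hx hxc
  have hxx : (chartAt E x ∘ φ.symm) (φ x) = chartAt E x x := by
    rw [Function.comp_apply, φ.left_inv hx]
  rw [(eventually_coord_eq_pullback hφ hc α hx hxc).extDeriv_eq,
    extDeriv_pullback (hxx ▸ hα.differentiableAt (by simp)) hT minSmoothness_two_le_infty,
    coord_apply_chart _ hx, hxx, hφ.fderiv_transition hc hx hxc]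
  have h1 : α.deRham.val x = (extDeriv (α.coord (chartAt E x)) (chartAt E x x)).compContinuousLinearMap
      (chartDeriv E (chartAt E x) x) := by
    rw [coord_chartAt]
    simp only [val, deRham, chartDeriv, mfld_simps]
    rfl
  rw [h1]
  rfl

omit [FiniteDimensional ℝ E] [FiniteDimensional ℝ V] in
theorem eventually_coord_deRham {φ : OpenPartialHomeomorph M V}
    (hφ : IsSmoothChart (E := E) φ) {α : FormField E M k} {x : M} (hx : x ∈ φ.source)
    (hα : ∀ᶠ y in 𝓝 x, α.SmoothAt y) :
    α.deRham.coord φ =ᶠ[𝓝 (φ x)] extDeriv (α.coord φ) := by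
  have h1 : ContinuousAt φ.symm (φ x) := φ.continuousAt_symm (φ.map_source hx)
  rw [ContinuousAt, φ.left_inv hx] at h1
  filter_upwards [h1.eventually hα, φ.open_target.mem_nhds (φ.map_source hx)] with y hy hyt
  have := coord_deRham hφ (φ.map_target hyt) hy
  rwa [φ.right_inv hyt] at this

end FormField

end Charts

/-! ### Leaf directions and smoothness of the projection onto them -/

section LeafGeometry

variable {E : Type*} [NormedAddCommGroup E] [NormedSpace ℝ E]
  {M : Type*} [TopologicalSpace M] [ChartedSpace E M] {p q k : ℕ}

/-- The model of distinguished charts. -/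
abbrev FoliationModel (p q : ℕ) := EuclideanSpace ℝ (Fin p) × EuclideanSpace ℝ (Fin q)

namespace Foliation

theorem isSmoothChart (F : Foliation E M p q) {φ : OpenPartialHomeomorph M (FoliationModel p q)}
    (hφ : φ ∈ F.charts) : IsSmoothChart (E := E) φ :=
  ⟨F.smooth φ hφ, F.smooth_symm φ hφ⟩

theorem mfderiv_snd_chart (F : Foliation E M p q)
    {φ : OpenPartialHomeomorph M (FoliationModel p q)} (hφ : φ ∈ F.charts) {x : M}
    (hx : x ∈ φ.source) (v : E) :
    mfderiv 𝓘(ℝ, E) 𝓘(ℝ, EuclideanSpace ℝ (Fin q)) (fun y => (φ y).2) x v =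
      (chartDeriv E φ x v).2 := by
  have h1 : MDifferentiableAt 𝓘(ℝ, E) 𝓘(ℝ, FoliationModel p q) φ x :=
    (F.isSmoothChart hφ).mdifferentiable.mdifferentiableAt hx
  have h2 : HasMFDerivAt 𝓘(ℝ, FoliationModel p q) 𝓘(ℝ, EuclideanSpace ℝ (Fin q))
      (Prod.snd : FoliationModel p q → _) (φ x)
      (ContinuousLinearMap.snd ℝ (EuclideanSpace ℝ (Fin p)) (EuclideanSpace ℝ (Fin q))) :=
    (hasFDerivAt_snd (𝕜 := ℝ)).hasMFDerivAt
  have h3 := (h2.comp x h1.hasMFDerivAt).mfderiv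
  exact DFunLike.congr_fun h3 v

variable [IsManifold 𝓘(ℝ, E) ∞ M]

/-- The leaf directions, as a subspace of the model space. -/
def tangentModel (F : Foliation E M p q) (x : M) : Submodule ℝ E := F.tangent x

/-- `tangent` intersects kernels over all distinguished charts at `x`; compatibility of the charts
makes these kernels equal, so one chart decides. -/
theorem mem_tangentModel_iff (F : Foliation E M p q)
    {φ : OpenPartialHomeomorph M (FoliationModel p q)} (hφ : φ ∈ F.charts) {x : M}
    (hx : x ∈ φ.source) {v : E} :
    v ∈ F.tangentModel x ↔ (chartDeriv E φ x v).2 = 0 := by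
  have h0 : ∀ v : TangentSpace 𝓘(ℝ, E) x, v ∈ F.tangent x ↔ ∀ ψ : OpenPartialHomeomorph M (FoliationModel p q),
      ψ ∈ F.charts ∧ x ∈ ψ.source → mfderiv 𝓘(ℝ, E) 𝓘(ℝ, EuclideanSpace ℝ (Fin q))
        (fun y => (ψ y).2) x v = 0 := by
    intro v
    simp only [tangent, Submodule.mem_iInf, Set.mem_ofPred_eq, LinearMap.mem_ker]
    rfl
  refine (h0 v).trans ?_
  constructor
  · intro h
    rw [← F.mfderiv_snd_chart hφ hx v]
    exact h φ ⟨hφ, hx⟩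
  · rintro h ψ ⟨hψ, hx'⟩
    refine (F.mfderiv_snd_chart hψ hx' v).trans ?_
    have hφs := F.isSmoothChart hφ
    have hψs := F.isSmoothChart hψ
    set u := chartDeriv E φ x v with hu
    have hT := ((hφs.contDiffAt_transition hψs hx hx').differentiableAt (by simp)).hasFDerivAt
    rw [hφs.fderiv_transition hψs hx hx'] at hT
    have hT2 := (hT.snd).hasLineDerivAt u
    rw [HasLineDerivAt] at hT2
    -- No differentiability of `g` is given, so the chain rule does not apply to it. Instead, along
    -- the line `φ x + t • u` with `u.2 = 0` the transverse coordinate of `φ` is constant, hence so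
    -- is that of `ψ`.
    obtain ⟨g, hg⟩ := F.compatible φ hφ ψ hψ x ⟨hx, hx'⟩
    have hc : ContinuousAt (fun t : ℝ => φ.symm (φ x + t • u)) 0 := by
      have h1 : ContinuousAt φ.symm (φ x + (0 : ℝ) • u) := by
        rw [zero_smul, add_zero]
        exact φ.continuousAt_symm (φ.map_source hx)
      exact ContinuousAt.comp (f := fun t : ℝ => φ x + t • u) h1 (by fun_prop)
    have hc' : ContinuousAt (fun t : ℝ => φ x + t • u) 0 := by fun_prop
    have hev : (fun t : ℝ => ((ψ ∘ φ.symm) (φ x + t • u)).2) =ᶠ[𝓝 0] fun _ => g (φ x).2 := by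
      rw [ContinuousAt] at hc hc'
      simp only [zero_smul, add_zero, φ.left_inv hx] at hc hc'
      filter_upwards [hc.eventually hg,
        hc'.eventually (φ.open_target.mem_nhds (φ.map_source hx))] with t ht htt
      rw [Function.comp_apply, ht, φ.right_inv htt]
      simp [h]
    have h0 := hT2.unique ((hasDerivAt_const (0 : ℝ) (g (φ x).2)).congr_of_eventuallyEq hev)
    have h4 : chartSymmDeriv E φ (φ x) u = v := hφs.symm_deriv_apply hx v
    refine Eq.trans ?_ h0
    change _ = (chartDeriv E ψ x (chartSymmDeriv E φ (φ x) u)).2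
    rw [h4]

end Foliation

namespace Foliation.TransversalDistribution

variable [FiniteDimensional ℝ E] [IsManifold 𝓘(ℝ, E) ∞ M] {F : Foliation E M p q}
  (ν : F.TransversalDistribution)

/-- The transversal directions, as a subspace of the model space. -/
def spaceModel (x : M) : Submodule ℝ E := ν.space x

/-- The projection onto the leaf directions, as a map of the model space. -/
def projModel (x : M) : E →L[ℝ] E := ν.proj x

theorem projModel_mem (x : M) (v : E) : ν.projModel x v ∈ F.tangentModel x :=
  Submodule.projection_apply_mem (ν.isCompl x) v

theorem projModel_eq_self {x : M} {v : E} (hv : v ∈ F.tangentModel x) : ν.projModel x v = v :=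
  Submodule.projection_apply_of_mem_left (ν.isCompl x) hv

theorem projModel_eq_zero_iff {x : M} {v : E} : ν.projModel x v = 0 ↔ v ∈ ν.spaceModel x :=
  Submodule.projection_apply_eq_zero_iff (ν.isCompl x)

theorem projModel_projModel (x : M) (v : E) : ν.projModel x (ν.projModel x v) = ν.projModel x v :=
  ν.projModel_eq_self (ν.projModel_mem x v)

theorem sub_projModel_mem (x : M) (v : E) : v - ν.projModel x v ∈ ν.spaceModel x := by
  rw [← ν.projModel_eq_zero_iff, map_sub, ν.projModel_projModel, sub_self]

theorem projModel_eq_of_decomp {x : M} {v t : E} (ht : t ∈ F.tangentModel x)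
    (hv : v - t ∈ ν.spaceModel x) : ν.projModel x v = t := by
  have h := ν.projModel_eq_zero_iff.2 hv
  rwa [map_sub, ν.projModel_eq_self ht, sub_eq_zero] at h

/-- The projection onto the leaf directions in a chart. -/
def coordProj (φ : OpenPartialHomeomorph M (FoliationModel p q)) (y : FoliationModel p q) :
    FoliationModel p q →L[ℝ] FoliationModel p q :=
  (chartDeriv E φ (φ.symm y)).comp ((ν.projModel (φ.symm y)).comp (chartSymmDeriv E φ y))

omit [FiniteDimensional ℝ E] in
/-- A smooth vector field is smooth in charts. -/
theorem _root_.IsSmoothChart.contDiffAt_vectorField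
    {φ : OpenPartialHomeomorph M (FoliationModel p q)}
    (hφ : IsSmoothChart (E := E) φ) {X : (y : M) → TangentSpace 𝓘(ℝ, E) y} {N : Set M} {x : M}
    (hX : ContMDiffOn 𝓘(ℝ, E) (𝓘(ℝ, E).prod 𝓘(ℝ, E)) ∞
      (fun y => (⟨y, X y⟩ : TangentBundle 𝓘(ℝ, E) M)) N) (hN : N ∈ 𝓝 x) (hx : x ∈ φ.source) :
    ContDiffAt ℝ ∞ (fun y => chartDeriv E φ (φ.symm y) ((fun z => X z : M → E) (φ.symm y))) (φ x) := by
  have h1 : ContMDiffOn 𝓘(ℝ, E).tangent 𝓘(ℝ, FoliationModel p q).tangent ∞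
      (tangentMapWithin 𝓘(ℝ, E) 𝓘(ℝ, FoliationModel p q) φ φ.source)
      (Bundle.TotalSpace.proj ⁻¹' φ.source) :=
    hφ.smooth.contMDiffOn_tangentMapWithin (m := ∞) (by simp) φ.open_source.uniqueMDiffOn
  have h2 : ContMDiffAt 𝓘(ℝ, E) (𝓘(ℝ, E).prod 𝓘(ℝ, E)) ∞
      (fun y => (⟨y, X y⟩ : TangentBundle 𝓘(ℝ, E) M)) x := hX.contMDiffAt hN
  have ho : IsOpen ((Bundle.TotalSpace.proj : TangentBundle 𝓘(ℝ, E) M → M) ⁻¹' φ.source) :=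
    φ.open_source.preimage (FiberBundle.continuous_proj E (TangentSpace 𝓘(ℝ, E)))
  have h3 := h1.contMDiffAt (x := (⟨x, X x⟩ : TangentBundle 𝓘(ℝ, E) M)) (ho.mem_nhds hx)
  have h4 := (contMDiff_snd_tangentBundle_modelSpace (FoliationModel p q)
    𝓘(ℝ, FoliationModel p q) (n := ∞)).contMDiffAt.comp x (h3.comp x h2)
  rw [← contMDiffAt_iff_contDiffAt]
  have h5 : ContMDiffAt 𝓘(ℝ, FoliationModel p q) 𝓘(ℝ, E) ∞ φ.symm (φ x) :=
    hφ.smooth_symm.contMDiffAt (φ.open_target.mem_nhds (φ.map_source hx))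
  refine ContMDiffAt.congr_of_eventuallyEq
    (ContMDiffAt.comp_of_eq h4 h5 (φ.left_inv hx)) ?_
  filter_upwards [φ.open_target.mem_nhds (φ.map_source hx)] with y hy
  have := mfderivWithin_of_isOpen (I := 𝓘(ℝ, E)) (I' := 𝓘(ℝ, FoliationModel p q)) (f := φ)
    φ.open_source (φ.map_target hy)
  exact (DFunLike.congr_fun this (X (φ.symm y))).symm

/-- The projection onto the leaf directions is smooth. -/
theorem contDiffAt_coordProj {φ : OpenPartialHomeomorph M (FoliationModel p q)}
    (hφ : φ ∈ F.charts) {x : M} (hx : x ∈ φ.source) :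
    ContDiffAt ℝ ∞ (ν.coordProj φ) (φ x) := by
  have hφs := F.isSmoothChart hφ
  obtain ⟨N, hN, X', hX, hspan'⟩ := ν.smooth x
  let X : Fin q → M → E := fun j z => X' j z
  have hspan : ∀ z ∈ N, ν.spaceModel z = Submodule.span ℝ (Set.range fun j => X j z) := hspan'
  -- `b y` sends coefficients to the corresponding combination of the local frame of `ν`, written in
  -- the chart; `B y` below keeps its transverse component.
  let b : FoliationModel p q → (EuclideanSpace ℝ (Fin q) →L[ℝ] FoliationModel p q) := fun y =>
    ∑ j, (EuclideanSpace.proj j : EuclideanSpace ℝ (Fin q) →L[ℝ] ℝ).smulRight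
      (chartDeriv E φ (φ.symm y) (X j (φ.symm y)))
  have hb : ContDiffAt ℝ ∞ b (φ x) := by
    refine ContDiffAt.sum fun j _ => ?_
    exact contDiffAt_const.smulRight (hφs.contDiffAt_vectorField (hX j) hN hx)
  have hb_apply : ∀ y w, b y w = chartDeriv E φ (φ.symm y) (∑ j, w j • X j (φ.symm y)) := by
    intro y w
    simp only [b, sum_apply, ContinuousLinearMap.smulRight_apply, map_sum, map_smul]
    rfl
  let B : FoliationModel p q → (EuclideanSpace ℝ (Fin q) →L[ℝ] EuclideanSpace ℝ (Fin q)) :=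
    fun y => (ContinuousLinearMap.snd ℝ _ _).comp (b y)
  have hB : ContDiffAt ℝ ∞ B (φ x) := contDiffAt_const.clm_comp hb
  have hsp : ∀ y, φ.symm y ∈ N → ∀ u : E, u ∈ ν.spaceModel (φ.symm y) ↔
      ∃ w : EuclideanSpace ℝ (Fin q), u = ∑ j, w j • X j (φ.symm y) := by
    intro y hy u
    rw [hspan _ hy, Submodule.mem_span_range_iff_exists_fun]
    constructor
    · rintro ⟨c, hc⟩
      exact ⟨WithLp.toLp 2 c, hc.symm⟩
    · rintro ⟨w, hw⟩
      exact ⟨fun j => w j, hw.symm⟩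
  -- Given `w`, the `ν`-component of the vector with coordinates `(0, w)` still has transverse part
  -- `w`, because removing a leaf vector does not change it. Hence `B y` is onto, and bijective by
  -- dimension.
  have hsurj : ∀ y ∈ φ.target, φ.symm y ∈ N → ∃ e : EuclideanSpace ℝ (Fin q) ≃L[ℝ]
      EuclideanSpace ℝ (Fin q), (e : EuclideanSpace ℝ (Fin q) →L[ℝ] _) = B y := by
    intro y hy hyN
    have hs : Function.Surjective (B y).toLinearMap := by
      intro w
      let v : E := chartSymmDeriv E φ y (0, w)
      obtain ⟨c, hc⟩ := (hsp y hyN _).1 (ν.sub_projModel_mem (φ.symm y) v)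
      refine ⟨c, ?_⟩
      change (b y c).2 = w
      have h1 : (chartDeriv E φ (φ.symm y) (ν.projModel (φ.symm y) v)).2 = 0 :=
        (F.mem_tangentModel_iff hφ (φ.map_target hy)).1 (ν.projModel_mem _ v)
      have h2 : chartDeriv E φ (φ.symm y) v = (0, w) :=
        DFunLike.congr_fun (hφs.comp_symm_deriv hy) (0, w)
      rw [hb_apply, ← hc, map_sub, Prod.snd_sub, h1, h2, sub_zero]
    have hinj := LinearMap.injective_iff_surjective.2 hs
    exact ⟨(LinearEquiv.ofBijective _ ⟨hinj, hs⟩).toContinuousLinearEquiv, by ext; rfl⟩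
  have hBi : ContDiffAt ℝ ∞ (fun y => (B y).inverse) (φ x) := by
    obtain ⟨e, he⟩ := hsurj (φ x) (φ.map_source hx) (by rw [φ.left_inv hx]; exact mem_of_mem_nhds hN)
    exact ContDiffAt.comp (φ x) (he ▸ contDiffAt_map_inverse e) hB
  -- Projecting along `ν` subtracts the frame combination with the same transverse part. The
  -- resulting formula is smooth because inversion of operators is smooth at invertible ones.
  have hP : ContDiffAt ℝ ∞ (fun y => ContinuousLinearMap.id ℝ (FoliationModel p q) -
      (b y).comp ((B y).inverse.comp (ContinuousLinearMap.snd ℝ _ _))) (φ x) :=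
    contDiffAt_const.sub (hb.clm_comp (hBi.clm_comp contDiffAt_const))
  refine hP.congr_of_eventuallyEq ?_
  have h1 : ContinuousAt φ.symm (φ x) := φ.continuousAt_symm (φ.map_source hx)
  rw [ContinuousAt, φ.left_inv hx] at h1
  filter_upwards [φ.open_target.mem_nhds (φ.map_source hx), h1.eventually hN] with y hy hyN
  obtain ⟨e, he⟩ := hsurj y hy hyN
  refine ContinuousLinearMap.ext fun u => ?_
  let w := (B y).inverse u.2
  have hw : (b y w).2 = u.2 := by
    change B y ((B y).inverse u.2) = u.2
    rw [← he, ContinuousLinearMap.inverse_equiv]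
    exact e.apply_symm_apply _
  change chartDeriv E φ (φ.symm y) (ν.projModel (φ.symm y) (chartSymmDeriv E φ y u)) = u - b y w
  have hcomp : ∀ u, chartDeriv E φ (φ.symm y) (chartSymmDeriv E φ y u) = u :=
    fun u => DFunLike.congr_fun (hφs.comp_symm_deriv hy) u
  have h2 : ν.projModel (φ.symm y) (chartSymmDeriv E φ y u) = chartSymmDeriv E φ y (u - b y w) := by
    refine ν.projModel_eq_of_decomp ?_ ?_
    · refine (F.mem_tangentModel_iff hφ (φ.map_target hy)).2 ?_
      refine (congrArg Prod.snd (hcomp (u - b y w))).trans ?_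
      rw [Prod.snd_sub, hw, sub_self]
    · refine (hsp y hyN _).2 ⟨w, ?_⟩
      refine (map_sub (chartSymmDeriv E φ y) u (u - b y w)).symm.trans ?_
      rw [sub_sub_cancel, hb_apply]
      have := hφs.symm_deriv_apply (φ.map_target hy) (∑ j, w j • X j (φ.symm y))
      rwa [φ.right_inv hy] at this
  rw [h2, hcomp]

end Foliation.TransversalDistribution

end LeafGeometry

/-! ### The leafwise differential and its dependence on leaf directions only -/

section LeafwiseDifferential

variable {E : Type*} [NormedAddCommGroup E] [NormedSpace ℝ E]
  {M : Type*} [TopologicalSpace M] [ChartedSpace E M] {p q k : ℕ}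

theorem wedgeOneForms_comp {V V' : Type*} [AddCommGroup V] [Module ℝ V] [TopologicalSpace V]
    [AddCommGroup V'] [Module ℝ V'] [TopologicalSpace V']
    (θ : Fin k → V →L[ℝ] ℝ) (L : V' →L[ℝ] V) :
    (wedgeOneForms θ).compContinuousLinearMap L = wedgeOneForms fun a => (θ a).comp L := rfl

/-- The differential of a function, as a map of the model space. -/
def funDeriv (E : Type*) [NormedAddCommGroup E] [NormedSpace ℝ E]
    {M : Type*} [TopologicalSpace M] [ChartedSpace E M] (f : M → ℝ) (x : M) : E →L[ℝ] ℝ :=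
  mfderiv 𝓘(ℝ, E) 𝓘(ℝ, ℝ) f x

section Functions

variable {V : Type*} [NormedAddCommGroup V] [NormedSpace ℝ V] {φ : OpenPartialHomeomorph M V}

theorem IsSmoothChart.contDiffAt_comp_symm (hφ : IsSmoothChart (E := E) φ) {f : M → ℝ} {x : M}
    (hx : x ∈ φ.source) (hf : ContMDiffAt 𝓘(ℝ, E) 𝓘(ℝ, ℝ) ∞ f x) :
    ContDiffAt ℝ ∞ (f ∘ φ.symm) (φ x) := by
  rw [← contMDiffAt_iff_contDiffAt]
  exact ContMDiffAt.comp_of_eq hf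
    (hφ.smooth_symm.contMDiffAt (φ.open_target.mem_nhds (φ.map_source hx))) (φ.left_inv hx)

theorem IsSmoothChart.contMDiffAt_of_comp_symm (hφ : IsSmoothChart (E := E) φ) {f : M → ℝ} {x : M}
    (hx : x ∈ φ.source) (hf : ContDiffAt ℝ ∞ (f ∘ φ.symm) (φ x)) :
    ContMDiffAt 𝓘(ℝ, E) 𝓘(ℝ, ℝ) ∞ f x := by
  rw [← contMDiffAt_iff_contDiffAt] at hf
  refine (hf.comp x (hφ.smooth.contMDiffAt (φ.open_source.mem_nhds hx))).congr_of_eventuallyEq ?_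
  filter_upwards [φ.open_source.mem_nhds hx] with y hy
  simp [φ.left_inv hy]

theorem IsSmoothChart.fderiv_comp_symm (hφ : IsSmoothChart (E := E) φ) {f : M → ℝ} {x : M}
    (hx : x ∈ φ.source) (hf : MDifferentiableAt 𝓘(ℝ, E) 𝓘(ℝ, ℝ) f x) :
    fderiv ℝ (f ∘ φ.symm) (φ x) = (funDeriv E f x).comp (chartSymmDeriv E φ (φ x)) := by
  rw [← mfderiv_eq_fderiv]
  have h1 : MDifferentiableAt 𝓘(ℝ, V) 𝓘(ℝ, E) φ.symm (φ x) :=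
    hφ.mdifferentiable.mdifferentiableAt_symm (φ.map_source hx)
  have h2 : MDifferentiableAt 𝓘(ℝ, E) 𝓘(ℝ, ℝ) f (φ.symm (φ x)) := by rwa [φ.left_inv hx]
  refine (mfderiv_comp (φ x) h2 h1).trans ?_
  change (funDeriv E f (φ.symm (φ x))).comp (chartSymmDeriv E φ (φ x)) = _
  rw [φ.left_inv hx]

end Functions

namespace FormField

theorem ext_val {α η : FormField E M k} {x : M} (h : α.val x = η.val x) : α x = η x := h

/-- The product of a function and a form. -/
def fsmul (f : M → ℝ) (α : FormField E M k) : FormField E M k := fun x => f x • α x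

/-- `dg₁ ∧ … ∧ dg_k` for functions `g₁, …, g_k`. -/
def wedgeFun (g : Fin k → M → ℝ) : FormField E M k := fun x =>
  (wedgeOneForms fun a => funDeriv E (g a) x : E [⋀^Fin k]→L[ℝ] ℝ)

theorem fsmul_apply (f : M → ℝ) (α : FormField E M k) (x : M) : fsmul f α x = f x • α x := rfl

section

variable [FiniteDimensional ℝ E] [IsManifold 𝓘(ℝ, E) ∞ M]

omit [FiniteDimensional ℝ E] in
theorem SmoothAt.fsmul {f : M → ℝ} {α : FormField E M k} {x : M}
    (hf : ContMDiffAt 𝓘(ℝ, E) 𝓘(ℝ, ℝ) ∞ f x) (hα : α.SmoothAt x) : (fsmul f α).SmoothAt x :=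
  ((isSmoothChart_chartAt x).contDiffAt_comp_symm (mem_chart_source E x) hf).smul hα

omit [FiniteDimensional ℝ E] [IsManifold 𝓘(ℝ, E) ∞ M] in
theorem SmoothAt.add {α η : FormField E M k} {x : M} (hα : α.SmoothAt x) (hη : η.SmoothAt x) :
    (α + η).SmoothAt x :=
  ContDiffAt.add (f := α.coord (chartAt E x)) (g := η.coord (chartAt E x)) hα hη

omit [FiniteDimensional ℝ E] [IsManifold 𝓘(ℝ, E) ∞ M] in
theorem smoothAt_zero {x : M} : (0 : FormField E M k).SmoothAt x :=
  contDiffAt_const (c := (0 : E [⋀^Fin k]→L[ℝ] ℝ))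

omit [FiniteDimensional ℝ E] [IsManifold 𝓘(ℝ, E) ∞ M] in
theorem SmoothAt.const_smul {α : FormField E M k} {x : M} (a : ℝ) (hα : α.SmoothAt x) :
    (a • α).SmoothAt x :=
  ContDiffAt.const_smul (f := α.coord (chartAt E x)) a hα

omit [FiniteDimensional ℝ E] [IsManifold 𝓘(ℝ, E) ∞ M] in
theorem SmoothAt.sum {κ : Type*} {s : Finset κ} {α : κ → FormField E M k} {x : M}
    (hα : ∀ i ∈ s, (α i).SmoothAt x) : (∑ i ∈ s, α i).SmoothAt x := by
  classical
  induction s using Finset.induction_on with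
  | empty => simpa using smoothAt_zero
  | insert a s has ih =>
    rw [Finset.sum_insert has]
    exact (hα a (Finset.mem_insert_self _ _)).add
      (ih fun i hi => hα i (Finset.mem_insert_of_mem hi))

omit [FiniteDimensional ℝ E] [IsManifold 𝓘(ℝ, E) ∞ M] in
theorem coord_wedgeFun {V : Type*} [NormedAddCommGroup V] [NormedSpace ℝ V]
    {φ : OpenPartialHomeomorph M V} (hφ : IsSmoothChart (E := E) φ)
    {g : Fin k → M → ℝ} {x : M} (hx : x ∈ φ.source)
    (hg : ∀ a, ContMDiffAt 𝓘(ℝ, E) 𝓘(ℝ, ℝ) ∞ (g a) x) :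
    (wedgeFun g : FormField E M k).coord φ (φ x) =
      wedgeOneForms fun a => fderiv ℝ (g a ∘ φ.symm) (φ x) := by
  rw [coord_apply_chart _ hx]
  refine (wedgeOneForms_comp (fun a => funDeriv E (g a) x) _).trans ?_
  congr 1
  funext a
  exact (hφ.fderiv_comp_symm hx ((hg a).mdifferentiableAt (by simp))).symm

omit [FiniteDimensional ℝ E] [IsManifold 𝓘(ℝ, E) ∞ M] in
theorem eventually_coord_wedgeFun {V : Type*} [NormedAddCommGroup V] [NormedSpace ℝ V]
    {φ : OpenPartialHomeomorph M V} (hφ : IsSmoothChart (E := E) φ)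
    {g : Fin k → M → ℝ} {x : M} (hx : x ∈ φ.source)
    (hg : ∀ᶠ y in 𝓝 x, ∀ a, ContMDiffAt 𝓘(ℝ, E) 𝓘(ℝ, ℝ) ∞ (g a) y) :
    (wedgeFun g : FormField E M k).coord φ =ᶠ[𝓝 (φ x)]
      fun y => wedgeOneForms fun a => fderiv ℝ (g a ∘ φ.symm) y := by
  have h1 : ContinuousAt φ.symm (φ x) := φ.continuousAt_symm (φ.map_source hx)
  rw [ContinuousAt, φ.left_inv hx] at h1
  filter_upwards [h1.eventually hg, φ.open_target.mem_nhds (φ.map_source hx)] with y hy hyt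
  have := coord_wedgeFun hφ (φ.map_target hyt) hy
  rwa [φ.right_inv hyt] at this

theorem smoothAt_wedgeFun {g : Fin k → M → ℝ} {x : M}
    (hg : ∀ᶠ y in 𝓝 x, ∀ a, ContMDiffAt 𝓘(ℝ, E) 𝓘(ℝ, ℝ) ∞ (g a) y) :
    (wedgeFun g : FormField E M k).SmoothAt x := by
  have hc := isSmoothChart_chartAt (E := E) x
  refine ContDiffAt.congr_of_eventuallyEq ?_
    (eventually_coord_wedgeFun hc (mem_chart_source E x) hg)
  refine contDiffAt_wedgeOneForms fun a => ?_
  exact (hc.contDiffAt_comp_symm (mem_chart_source E x) (hg.self_of_nhds a)).fderiv_right (by simp)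

theorem val_deRham_fsmul_wedgeFun {f : M → ℝ} {g : Fin k → M → ℝ} {x : M}
    (hf : ContMDiffAt 𝓘(ℝ, E) 𝓘(ℝ, ℝ) ∞ f x)
    (hg : ∀ᶠ y in 𝓝 x, ∀ a, ContMDiffAt 𝓘(ℝ, E) 𝓘(ℝ, ℝ) ∞ (g a) y) :
    (fsmul f (wedgeFun g : FormField E M k)).deRham.val x =
      wedgeOneForms (Fin.cons (funDeriv E f x) fun a => funDeriv E (g a) x :
        Fin (k + 1) → E →L[ℝ] ℝ) := by
  have hc := isSmoothChart_chartAt (E := E) x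
  have hxc := mem_chart_source E x
  have hfc := hc.contDiffAt_comp_symm hxc hf
  have hgc := fun a => hc.contDiffAt_comp_symm hxc (hg.self_of_nhds a)
  have hs : (fsmul f (wedgeFun g : FormField E M k)).SmoothAt x :=
    (smoothAt_wedgeFun hg).fsmul hf
  have hco : (fsmul f (wedgeFun g : FormField E M k)).coord (chartAt E x) =ᶠ[𝓝 (chartAt E x x)]
      fun y => (f ∘ (chartAt E x).symm) y •
        wedgeOneForms fun a => fderiv ℝ (g a ∘ (chartAt E x).symm) y := by
    filter_upwards [eventually_coord_wedgeFun hc hxc hg] with y hy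
    change f ((chartAt E x).symm y) • (wedgeFun g : FormField E M k).coord (chartAt E x) y = _
    rw [hy]
    rfl
  rw [val_eq_coord hc _ hxc, coord_deRham hc hxc hs, hco.extDeriv_eq,
    extDeriv_smul_wedgeOneForms_fderiv hfc hgc, wedgeOneForms_comp]
  congr 1
  funext i
  have key : ∀ {f' : M → ℝ}, ContMDiffAt 𝓘(ℝ, E) 𝓘(ℝ, ℝ) ∞ f' x →
      (fderiv ℝ (f' ∘ (chartAt E x).symm) (chartAt E x x)).comp (chartDeriv E (chartAt E x) x) =
        funDeriv E f' x := by
    intro f' hf'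
    rw [hc.fderiv_comp_symm hxc (hf'.mdifferentiableAt (by simp)),
      ContinuousLinearMap.comp_assoc, hc.symm_comp_deriv hxc, ContinuousLinearMap.comp_id]
  refine Fin.cases ?_ (fun a => ?_) i
  · exact key hf
  · exact key (hg.self_of_nhds a)

end

end FormField

namespace Foliation.TransversalDistribution

variable [FiniteDimensional ℝ E] [IsManifold 𝓘(ℝ, E) ∞ M] {F : Foliation E M p q}
  (ν : F.TransversalDistribution)

open FormField

/-- The component of type `(0, k)` of a form. -/
def leafPart (α : FormField E M k) : FormField E M k :=
  fun x => (α x).compContinuousLinearMap (ν.proj x)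

theorem val_leafPart (α : FormField E M k) (x : M) :
    (ν.leafPart α).val x = (α.val x).compContinuousLinearMap (ν.projModel x) := rfl

theorem val_dLeaf (α : FormField E M k) (x : M) :
    (ν.dLeaf α).val x = (α.deRham.val x).compContinuousLinearMap (ν.projModel x) := rfl

theorem dLeaf_eq_leafPart (α : FormField E M k) : ν.dLeaf α = ν.leafPart α.deRham := rfl

theorem leafPart_congr_tangent {α η : FormField E M k} {x : M}
    (h : ∀ v : Fin k → E, (∀ i, v i ∈ F.tangentModel x) → α.val x v = η.val x v) :
    ν.leafPart α x = ν.leafPart η x := by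
  refine ext_val ?_
  ext v
  exact h _ fun i => ν.projModel_mem x (v i)

theorem val_leafPart_apply_of_mem (α : FormField E M k) {x : M} {v : Fin k → E}
    (hv : ∀ i, v i ∈ F.tangentModel x) : (ν.leafPart α).val x v = α.val x v := by
  rw [val_leafPart, ContinuousAlternatingMap.compContinuousLinearMap_apply]
  congr 1
  funext i
  exact ν.projModel_eq_self (hv i)

/-- A form vanishes when one argument is transversal iff it coincides with its `(0, k)`-part. -/
theorem leafPart_eq_self_iff (α : FormField E M k) (x : M) :
    (∀ v, (∃ j, v j ∈ ν.space x) → α x v = 0) ↔ ν.leafPart α x = α x := by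
  constructor
  · intro h
    refine ext_val ?_
    ext v
    rw [val_leafPart, ContinuousAlternatingMap.compContinuousLinearMap_apply]
    -- Expanding multilinearly in leaf and transversal components, every term except the purely
    -- leafwise one has a transversal argument and vanishes.
    have hv : v = (fun i => ν.projModel x (v i)) + fun i => v i - ν.projModel x (v i) := by
      funext i; simp
    conv_rhs => rw [hv]
    have := (α.val x).toMultilinearMap.map_add_univ (fun i => ν.projModel x (v i))
      (fun i => v i - ν.projModel x (v i))
    refine Eq.trans ?_ this.symm
    rw [Finset.sum_eq_single Finset.univ]
    · simp
      rfl
    · intro s _ hs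
      obtain ⟨j, hj⟩ : ∃ j, j ∉ s := by
        by_contra! hc
        exact hs (Finset.eq_univ_iff_forall.2 hc)
      refine h _ ⟨j, ?_⟩
      rw [Finset.piecewise_eq_of_notMem _ _ _ hj]
      exact ν.sub_projModel_mem x (v j)
    · simp
  · rintro h v ⟨j, hj⟩
    rw [← h]
    exact (α x).map_coord_zero j ((ν.projModel_eq_zero_iff).2 hj)

theorem leafPart_leafPart (α : FormField E M k) (x : M) :
    ν.leafPart (ν.leafPart α) x = ν.leafPart α x :=
  ν.leafPart_congr_tangent fun _ hv => ν.val_leafPart_apply_of_mem α hv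

variable {ν}

theorem coord_leafPart {φ : OpenPartialHomeomorph M (FoliationModel p q)} (hφ : φ ∈ F.charts)
    (α : FormField E M k) {y : FoliationModel p q} (hy : y ∈ φ.target) :
    (ν.leafPart α).coord φ y = (α.coord φ y).compContinuousLinearMap (ν.coordProj φ y) := by
  have h : (ν.leafPart α).val (φ.symm y) =
      (α.val (φ.symm y)).compContinuousLinearMap (ν.projModel (φ.symm y)) := rfl
  have h2 := val_eq_coord (F.isSmoothChart hφ) α (φ.map_target hy)
  rw [φ.right_inv hy] at h2
  rw [coord, h, h2]
  rfl

theorem _root_.FormField.SmoothAt.leafPart (ν : F.TransversalDistribution)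
    {α : FormField E M k} {x : M} (hα : α.SmoothAt x) :
    (ν.leafPart α).SmoothAt x := by
  obtain ⟨φ, hφ, hx⟩ := F.covers x
  have hφs := F.isSmoothChart hφ
  rw [smoothAt_iff_coord hφs hx] at hα ⊢
  refine (hα.alternatingMap_comp (ν.contDiffAt_coordProj hφ hx)).congr_of_eventuallyEq ?_
  filter_upwards [φ.open_target.mem_nhds (φ.map_source hx)] with y hy
  exact coord_leafPart hφ α hy

omit [FiniteDimensional ℝ E] in
theorem smoothAt_deRham {α : FormField E M k} {x : M} (hα : ∀ᶠ y in 𝓝 x, α.SmoothAt y) :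
    α.deRham.SmoothAt x := by
  refine ContDiffAt.congr_of_eventuallyEq ?_
    (eventually_coord_deRham (isSmoothChart_chartAt x) (mem_chart_source E x) hα)
  exact ContDiffAt.extDeriv hα.self_of_nhds

theorem smoothAt_dLeaf (ν : F.TransversalDistribution)
    {α : FormField E M k} {x : M} (hα : ∀ᶠ y in 𝓝 x, α.SmoothAt y) :
    (ν.dLeaf α).SmoothAt x :=
  (smoothAt_deRham hα).leafPart ν

/-- If a form vanishes on the tangent spaces of the leaves, so does its differential. -/
theorem val_deRham_apply_eq_zero {α : FormField E M k} {x : M} (hα : α.SmoothAt x)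
    (h : ∀ᶠ y in 𝓝 x, ∀ v : Fin k → E, (∀ i, v i ∈ F.tangentModel y) → α.val y v = 0)
    {v : Fin (k + 1) → E} (hv : ∀ i, v i ∈ F.tangentModel x) : α.deRham.val x v = 0 := by
  obtain ⟨φ, hφ, hx⟩ := F.covers x
  have hφs := F.isSmoothChart hφ
  rw [val_eq_coord hφs _ hx, coord_deRham hφs hx hα]
  -- In a distinguished chart the leaf directions are the constant subspace of vectors without
  -- transverse component. This is where integrability enters.
  refine extDeriv_apply_eq_zero (((smoothAt_iff_coord hφs hx).1 hα).differentiableAt (by simp))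
    (LinearMap.ker (LinearMap.snd ℝ (EuclideanSpace ℝ (Fin p)) (EuclideanSpace ℝ (Fin q)))) ?_ ?_
  · have h1 : ContinuousAt φ.symm (φ x) := φ.continuousAt_symm (φ.map_source hx)
    rw [ContinuousAt, φ.left_inv hx] at h1
    filter_upwards [h1.eventually h, φ.open_target.mem_nhds (φ.map_source hx)] with y hy hyt w hw
    refine hy _ fun i => ?_
    refine (F.mem_tangentModel_iff hφ (φ.map_target hyt)).2 ?_
    have := DFunLike.congr_fun (hφs.comp_symm_deriv hyt) (w i)
    refine (congrArg Prod.snd this).trans ?_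
    exact hw i
  · intro i
    exact (F.mem_tangentModel_iff hφ hx).1 (hv i)

theorem dLeaf_congr {α η : FormField E M k} {x : M} (h : ∀ᶠ y in 𝓝 x, α y = η y) :
    ν.dLeaf α x = ν.dLeaf η x := by
  unfold dLeaf
  rw [deRham_congr h]

omit [FiniteDimensional ℝ E] [IsManifold 𝓘(ℝ, E) ∞ M] in
theorem deRham_add_of_smoothAt {α η : FormField E M k} {x : M} (hα : α.SmoothAt x)
    (hη : η.SmoothAt x) : (α + η).deRham x = α.deRham x + η.deRham x := by
  have key : ∀ {β : FormField E M k}, β.SmoothAt x →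
      DifferentiableAt ℝ (β.inChart x) (extChartAt 𝓘(ℝ, E) x x) := by
    intro β hβ
    have := ContDiffAt.differentiableAt hβ (by simp)
    rw [coord_chartAt] at this
    simpa only [mfld_simps] using this
  unfold deRham
  rw [inChart_add, extDeriv_add (key hα) (key hη)]
  rfl

theorem dLeaf_add_of_smoothAt {α η : FormField E M k} {x : M} (hα : α.SmoothAt x)
    (hη : η.SmoothAt x) : ν.dLeaf (α + η) x = ν.dLeaf α x + ν.dLeaf η x := by
  unfold dLeaf
  rw [deRham_add_of_smoothAt hα hη]
  rfl

theorem dLeaf_sum {κ : Type*} {s : Finset κ} {α : κ → FormField E M k} {x : M}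
    (hα : ∀ i ∈ s, (α i).SmoothAt x) : ν.dLeaf (∑ i ∈ s, α i) x = ∑ i ∈ s, ν.dLeaf (α i) x := by
  classical
  induction s using Finset.induction_on with
  | empty => simpa using ν.dLeaf_zero x
  | insert a s has ih =>
    have hs := fun i hi => hα i (Finset.mem_insert_of_mem (a := i) (b := a) hi)
    rw [Finset.sum_insert has, Finset.sum_insert has,
      dLeaf_add_of_smoothAt (hα a (Finset.mem_insert_self _ _)) (SmoothAt.sum hs), ih hs]

omit [FiniteDimensional ℝ E] [IsManifold 𝓘(ℝ, E) ∞ M] in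
theorem deRham_sub {α η : FormField E M k} {x : M} (hα : α.SmoothAt x) (hη : η.SmoothAt x) :
    (α - η).deRham.val x = α.deRham.val x - η.deRham.val x := by
  have h := deRham_add_of_smoothAt hα (hη.const_smul (-1))
  rw [neg_smul, one_smul, ← sub_eq_add_neg] at h
  refine h.trans ?_
  have h2 := deRham_smul (-1 : ℝ) η x
  rw [neg_smul, one_smul] at h2
  rw [h2]
  ext v
  change α.deRham.val x v + (-1 : ℝ) * η.deRham.val x v = α.deRham.val x v - η.deRham.val x v
  ring

/-- The leafwise differential only depends on the restriction of a form to the leaves. -/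
theorem dLeaf_congr_tangent {α η : FormField E M k} {x : M} (hα : α.SmoothAt x)
    (hη : η.SmoothAt x)
    (h : ∀ᶠ y in 𝓝 x, ∀ v : Fin k → E, (∀ i, v i ∈ F.tangentModel y) → α.val y v = η.val y v) :
    ν.dLeaf α x = ν.dLeaf η x := by
  refine ν.leafPart_congr_tangent fun v hv => ?_
  have hs : (α - η).SmoothAt x := by
    have := hα.add (hη.const_smul (-1))
    rwa [neg_smul, one_smul, ← sub_eq_add_neg] at this
  have h0 := val_deRham_apply_eq_zero (F := F) hs
    (h.mono fun y hy w hw => sub_eq_zero.2 (hy w hw)) hv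
  rw [deRham_sub hα hη] at h0
  exact sub_eq_zero.1 h0

/-- A form and its leaf part agree on leaf directions. Consequently identities for `d''` can be
proved for ordinary forms with the ordinary differential and projected at the end. -/
theorem dLeaf_leafPart {α : FormField E M k} {x : M} (hα : α.SmoothAt x) :
    ν.dLeaf (ν.leafPart α) x = ν.dLeaf α x :=
  dLeaf_congr_tangent (hα.leafPart ν) hα
    (Filter.Eventually.of_forall fun _ _ hv => ν.val_leafPart_apply_of_mem α hv)

omit [FiniteDimensional ℝ E] in
theorem deRham_deRham {α : FormField E M k} {x : M} (hα : ∀ᶠ y in 𝓝 x, α.SmoothAt y) :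
    α.deRham.deRham x = 0 := by
  have hc := isSmoothChart_chartAt (E := E) x
  have hxc := mem_chart_source E x
  refine ext_val (α := α.deRham.deRham) (η := 0) ?_
  rw [val_eq_coord hc _ hxc, coord_deRham hc hxc (smoothAt_deRham hα),
    (eventually_coord_deRham hc hxc hα).extDeriv_eq,
    extDeriv_extDeriv_apply hα.self_of_nhds minSmoothness_two_le_infty]
  rfl

/-- `d'' ∘ d'' = 0`. -/
theorem dLeaf_dLeaf {α : FormField E M k} {x : M} (hα : ∀ᶠ y in 𝓝 x, α.SmoothAt y) :
    ν.dLeaf (ν.dLeaf α) x = 0 := by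
  rw [ν.dLeaf_eq_leafPart α, dLeaf_leafPart (smoothAt_deRham hα)]
  refine ext_val (α := ν.dLeaf α.deRham) (η := 0) ?_
  rw [val_dLeaf]
  have : α.deRham.deRham.val x = 0 := deRham_deRham hα
  rw [this]
  rfl

/-- `d''g₁ ∧ … ∧ d''g_k` for functions `g₁, …, g_k`. -/
def leafWedge (ν : F.TransversalDistribution) (g : Fin k → M → ℝ) : FormField E M k :=
  fun x => wedgeOneForms fun a => ν.dLeafFun (g a) x

theorem smoothAt_leafWedge {g : Fin k → M → ℝ} {x : M}
    (hg : ∀ᶠ y in 𝓝 x, ∀ a, ContMDiffAt 𝓘(ℝ, E) 𝓘(ℝ, ℝ) ∞ (g a) y) :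
    (ν.leafWedge g).SmoothAt x :=
  (smoothAt_wedgeFun hg).leafPart ν

/-- `d''(f d''g₁ ∧ … ∧ d''g_k) = d''f ∧ d''g₁ ∧ … ∧ d''g_k`. -/
theorem dLeaf_fsmul_leafWedge {f : M → ℝ} {g : Fin k → M → ℝ} {x : M}
    (hf : ContMDiffAt 𝓘(ℝ, E) 𝓘(ℝ, ℝ) ∞ f x)
    (hg : ∀ᶠ y in 𝓝 x, ∀ a, ContMDiffAt 𝓘(ℝ, E) 𝓘(ℝ, ℝ) ∞ (g a) y) :
    ν.dLeaf (fsmul f (ν.leafWedge g)) x =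
      wedgeOneForms (Fin.cons (ν.dLeafFun f x) fun a => ν.dLeafFun (g a) x :
        Fin (k + 1) → TangentSpace 𝓘(ℝ, E) x →L[ℝ] ℝ) := by
  -- Since the form is the leaf part of `f dg₁ ∧ … ∧ dg_k`, the ordinary formula for the
  -- differential applies before projection.
  have h1 : fsmul f (ν.leafWedge g) = ν.leafPart (fsmul f (wedgeFun g)) := rfl
  rw [h1, dLeaf_leafPart ((smoothAt_wedgeFun hg).fsmul hf)]
  refine ext_val (α := ν.dLeaf _) (η := fun x => wedgeOneForms (Fin.cons (ν.dLeafFun f x)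
    fun a => ν.dLeafFun (g a) x : Fin (k + 1) → TangentSpace 𝓘(ℝ, E) x →L[ℝ] ℝ)) ?_
  rw [val_dLeaf, val_deRham_fsmul_wedgeFun hf hg, wedgeOneForms_comp]
  have : ∀ θ θ' : Fin (k + 1) → E →L[ℝ] ℝ, θ = θ' → wedgeOneForms θ = wedgeOneForms θ' :=
    fun _ _ h => congrArg _ h
  refine this _ _ ?_
  funext i
  refine Fin.cases ?_ (fun a => ?_) i
  · rfl
  · rfl

end Foliation.TransversalDistribution

end LeafwiseDifferential

/-! ### Functions constant on leaves as solutions of `d''f = 0` -/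

section Projectable

variable {E : Type*} [NormedAddCommGroup E] [NormedSpace ℝ E]
  {M : Type*} [TopologicalSpace M] [ChartedSpace E M] {p q : ℕ}
  [IsManifold 𝓘(ℝ, E) ∞ M]

namespace Foliation

/-- A function constant on the leaves of `W` has vanishing derivative in the leaf directions. -/
theorem funDeriv_eq_zero_of_sameLeaf (F : Foliation E M p q) {W : Set M} (hW : IsOpen W)
    {f : M → ℝ} (hleaf : ∀ x y, F.SameLeaf W x y → f x = f y) {x : M} (hx : x ∈ W)
    (hf : MDifferentiableAt 𝓘(ℝ, E) 𝓘(ℝ, ℝ) f x) {v : E} (hv : v ∈ F.tangentModel x) :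
    funDeriv E f x v = 0 := by
  obtain ⟨φ, hφ, hxφ⟩ := F.covers x
  have hφs := F.isSmoothChart hφ
  set u := chartDeriv E φ x v with hu
  have hu2 : u.2 = 0 := (F.mem_tangentModel_iff hφ hxφ).1 hv
  have hopen : IsOpen (φ.target ∩ φ.symm ⁻¹' W) :=
    φ.isOpen_inter_preimage_symm hW
  obtain ⟨r, hr, hball⟩ := Metric.isOpen_iff.1 hopen (φ x)
    ⟨φ.map_source hxφ, by simpa [φ.left_inv hxφ] using hx⟩
  have hcont : ContinuousAt (fun t : ℝ => φ x + t • u) 0 := by fun_prop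
  have hev : ∀ᶠ t : ℝ in 𝓝 0, φ x + t • u ∈ Metric.ball (φ x) r :=
    hcont.eventually_mem (by
      rw [zero_smul, add_zero]
      exact Metric.ball_mem_nhds _ hr)
  have hconst : (fun t : ℝ => (f ∘ φ.symm) (φ x + t • u)) =ᶠ[𝓝 0] fun _ => f x := by
    filter_upwards [hev] with t ht
    refine (hleaf _ _ ?_).symm
    -- The segment in direction `t • u` has constant transverse coordinate because `u.2 = 0`, so it
    -- gives a path in a leaf; the ball keeps it inside the chart and `W`.
    have hseg : ∀ s : unitInterval, φ x + (s : ℝ) • t • u ∈ φ.target ∩ φ.symm ⁻¹' W := by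
      intro s
      refine hball ?_
      rw [Metric.mem_ball, dist_self_add_left] at ht ⊢
      rw [norm_smul]
      refine lt_of_le_of_lt (mul_le_of_le_one_left (norm_nonneg _) ?_) ht
      rw [Real.norm_eq_abs, abs_of_nonneg s.2.1]
      exact s.2.2
    refine ⟨⟨⟨fun s => φ.symm (φ x + (s : ℝ) • t • u), ?_⟩, ?_, ?_⟩, fun s => (hseg s).2, fun s =>
      ⟨φ, hφ, φ.map_target (hseg s).1, Filter.Eventually.of_forall fun s' => ?_⟩⟩
    · refine continuous_iff_continuousAt.2 fun s => ?_
      exact ContinuousAt.comp (f := fun s : unitInterval => φ x + (s : ℝ) • t • u)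
        (φ.continuousAt_symm (hseg s).1) (by fun_prop)
    · simp [φ.left_inv hxφ]
    · simp
    · change (φ (φ.symm (φ x + (s' : ℝ) • t • u))).2 = (φ (φ.symm (φ x + (s : ℝ) • t • u))).2
      rw [φ.right_inv (hseg s').1, φ.right_inv (hseg s).1]
      simp [hu2]
  have hdiff : DifferentiableAt ℝ (f ∘ φ.symm) (φ x) := by
    rw [← mdifferentiableAt_iff_differentiableAt]
    refine MDifferentiableAt.comp (I' := 𝓘(ℝ, E)) (φ x) ?_
      (hφs.mdifferentiable.mdifferentiableAt_symm (φ.map_source hxφ))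
    rwa [φ.left_inv hxφ]
  have h1 := hdiff.hasFDerivAt.hasLineDerivAt u
  rw [hφs.fderiv_comp_symm hxφ hf] at h1
  have h2 := HasDerivAt.unique h1
    ((hasDerivAt_const (0 : ℝ) (f x)).congr_of_eventuallyEq hconst)
  rw [ContinuousLinearMap.comp_apply, hu, hφs.symm_deriv_apply hxφ] at h2
  exact h2

/-- A function whose derivative vanishes in the leaf directions is constant on leaves. -/
theorem eq_of_sameLeaf_of_funDeriv_eq_zero (F : Foliation E M p q) {W : Set M} (hW : IsOpen W)
    {f : M → ℝ} (hf : ∀ x ∈ W, MDifferentiableAt 𝓘(ℝ, E) 𝓘(ℝ, ℝ) f x)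
    (hd : ∀ x ∈ W, ∀ v ∈ F.tangentModel x, funDeriv E f x v = 0) {x y : M}
    (hxy : F.SameLeaf W x y) : f x = f y := by
  obtain ⟨γ, hγW, hγ⟩ := hxy
  -- `γ` is only continuous, so `f ∘ γ` is not differentiated. Points `γ s` near `γ t` are instead
  -- joined to it by straight segments in a distinguished chart, which have constant transverse
  -- coordinate.
  have hloc : IsLocallyConstant fun t => f (γ t) := by
    rw [IsLocallyConstant.iff_eventually_eq]
    intro t
    obtain ⟨φ, hφ, hzφ, hconst⟩ := hγ t
    have hφs := F.isSmoothChart hφ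
    have hopen : IsOpen (φ.target ∩ φ.symm ⁻¹' W) := φ.isOpen_inter_preimage_symm hW
    obtain ⟨r, hr, hball⟩ := Metric.isOpen_iff.1 hopen (φ (γ t))
      ⟨φ.map_source hzφ, by simpa [φ.left_inv hzφ] using hγW t⟩
    have hcont : ContinuousAt (fun s => φ (γ s)) t :=
      (φ.continuousAt hzφ).comp γ.continuous.continuousAt
    filter_upwards [hconst, hcont.eventually (Metric.ball_mem_nhds _ hr),
      γ.continuous.continuousAt.eventually (φ.open_source.mem_nhds hzφ)] with s hs hsb hsφ
    set a := φ (γ t) with ha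
    set b := φ (γ s) with hb
    have hseg : ∀ τ ∈ Set.Icc (0 : ℝ) 1, a + τ • (b - a) ∈ φ.target ∩ φ.symm ⁻¹' W := by
      intro τ hτ
      refine hball ?_
      rw [dist_eq_norm] at hsb
      rw [mem_ball_iff_norm, add_sub_cancel_left, norm_smul]
      refine lt_of_le_of_lt (mul_le_of_le_one_left (norm_nonneg _) ?_) hsb
      rw [Real.norm_eq_abs, abs_of_nonneg hτ.1]
      exact hτ.2
    have hder : ∀ τ ∈ Set.Icc (0 : ℝ) 1,
        HasDerivAt (fun τ : ℝ => (f ∘ φ.symm) (a + τ • (b - a))) 0 τ := by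
      intro τ hτ
      obtain ⟨h1, h2⟩ := hseg τ hτ
      have hsrc := φ.map_target h1
      have hdiff : DifferentiableAt ℝ (f ∘ φ.symm) (a + τ • (b - a)) := by
        rw [← mdifferentiableAt_iff_differentiableAt]
        exact MDifferentiableAt.comp (I' := 𝓘(ℝ, E)) _ (hf _ h2)
          (hφs.mdifferentiable.mdifferentiableAt_symm h1)
      have h3 := hφs.fderiv_comp_symm hsrc (hf _ h2)
      rw [φ.right_inv h1] at h3
      have h4 : HasDerivAt (fun τ : ℝ => a + τ • (b - a)) (b - a) τ := by
        simpa using ((hasDerivAt_id τ).smul_const (b - a)).const_add a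
      have h5 := hdiff.hasFDerivAt.comp_hasDerivAt τ h4
      suffices h0 : fderiv ℝ (f ∘ φ.symm) (a + τ • (b - a)) (b - a) = 0 by
        rw [h0] at h5
        exact h5
      rw [h3, ContinuousLinearMap.comp_apply]
      refine hd _ h2 _ ?_
      refine (F.mem_tangentModel_iff hφ hsrc).2 ?_
      have h6 := DFunLike.congr_fun (hφs.comp_symm_deriv h1) (b - a)
      refine (congrArg Prod.snd h6).trans ?_
      exact sub_eq_zero.2 hs
    have h7 := constant_of_has_deriv_right_zero
      (fun τ hτ => (hder τ hτ).continuousAt.continuousWithinAt)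
      (fun τ hτ => (hder τ ⟨hτ.1, hτ.2.le⟩).hasDerivWithinAt) 1 ⟨zero_le_one, le_rfl⟩
    simp only [one_smul, add_sub_cancel, zero_smul, add_zero, Function.comp_apply] at h7
    rwa [ha, hb, φ.left_inv hsφ, φ.left_inv hzφ] at h7
  have := hloc.apply_eq_of_preconnectedSpace 0 1
  simpa using this

variable [FiniteDimensional ℝ E]

theorem TransversalDistribution.dLeafFun_eq_zero_iff {F : Foliation E M p q}
    (ν : F.TransversalDistribution) {f : M → ℝ} {x : M} :
    ν.dLeafFun f x = 0 ↔ ∀ v ∈ F.tangentModel x, funDeriv E f x v = 0 := by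
  constructor
  · intro h v hv
    have h1 : (funDeriv E f x).comp (ν.projModel x) = 0 := h
    have h2 := DFunLike.congr_fun h1 v
    rwa [ContinuousLinearMap.comp_apply, ν.projModel_eq_self hv] at h2
  · intro h
    have h1 : (funDeriv E f x).comp (ν.projModel x) = 0 := by
      ext v
      exact h _ (ν.projModel_mem x v)
    exact h1

/-- Turns the condition on paths in leaves into a pointwise differential equation, so that `P⁰`
becomes the kernel of `d''` on functions. -/
theorem TransversalDistribution.mem_projectable_iff {F : Foliation E M p q}
    (ν : F.TransversalDistribution) {W : Set M} (hW : IsOpen W) {f : M → ℝ} :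
    f ∈ F.projectable W ↔ (∀ x ∈ W, ContMDiffAt 𝓘(ℝ, E) 𝓘(ℝ, ℝ) ∞ f x) ∧
      (∀ x ∈ W, ν.dLeafFun f x = 0) ∧ ∀ x ∉ W, f x = 0 := by
  have hsm : ContMDiffOn 𝓘(ℝ, E) 𝓘(ℝ, ℝ) ∞ f W ↔
      ∀ x ∈ W, ContMDiffAt 𝓘(ℝ, E) 𝓘(ℝ, ℝ) ∞ f x :=
    ⟨fun h x hx => h.contMDiffAt (hW.mem_nhds hx), fun h x hx => (h x hx).contMDiffWithinAt⟩
  change ContMDiffOn 𝓘(ℝ, E) 𝓘(ℝ, ℝ) ∞ f W ∧ _ ∧ _ ↔ _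
  rw [hsm]
  refine and_congr_right fun hf => and_congr_left fun _ => ⟨fun h x hx => ?_, fun h x y hxy => ?_⟩
  · exact ν.dLeafFun_eq_zero_iff.2 fun v hv =>
      F.funDeriv_eq_zero_of_sameLeaf hW h hx ((hf x hx).mdifferentiableAt (by simp)) hv
  · exact F.eq_of_sameLeaf_of_funDeriv_eq_zero hW
      (fun z hz => (hf z hz).mdifferentiableAt (by simp))
      (fun z hz => ν.dLeafFun_eq_zero_iff.1 (h z hz)) hxy

end Foliation

end Projectable

/-! ### The algebra of alternating face sums -/

section AlternatingCoface

variable {κ G : Type*} [AddCommGroup G] [Module ℝ G]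

/-- The alternating sum over the faces of a tuple. -/
def altFaces {n : ℕ} (c : (Fin n → κ) → G) (σ : Fin (n + 1) → κ) : G :=
  ∑ j : Fin (n + 1), (-1 : ℝ) ^ (j : ℕ) • c (fun a => σ (j.succAbove a))

theorem altFaces_congr {n : ℕ} {c c' : (Fin n → κ) → G} {σ : Fin (n + 1) → κ}
    (h : ∀ j : Fin (n + 1), c (fun a => σ (j.succAbove a)) = c' fun a => σ (j.succAbove a)) :
    altFaces c σ = altFaces c' σ :=
  Finset.sum_congr rfl fun j _ => by rw [h]

theorem altFaces_sub {n : ℕ} (c c' : (Fin n → κ) → G) (σ : Fin (n + 1) → κ) :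
    altFaces (c - c') σ = altFaces c σ - altFaces c' σ := by
  simp [altFaces, smul_sub]

/-- The zeroth face deletes `i`; all others keep it and shift the face number by one, whence the
minus sign. This recursion underlies both `δ ∘ δ = 0` and the contracting homotopy. -/
theorem altFaces_cons {n : ℕ} (c : (Fin (n + 1) → κ) → G) (i : κ) (τ : Fin (n + 1) → κ) :
    altFaces c (Fin.cons i τ : Fin (n + 2) → κ) =
      c τ - altFaces (fun σ : Fin n → κ => c (Fin.cons i σ : Fin (n + 1) → κ)) τ := by
  rw [altFaces, Fin.sum_univ_succ, altFaces, sub_eq_add_neg, ← Finset.sum_neg_distrib]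
  congr 1
  · simp
  · refine Finset.sum_congr rfl fun j _ => ?_
    rw [Fin.val_succ, pow_succ, mul_neg_one, neg_smul]
    congr 3
    funext a
    refine Fin.cases ?_ (fun b => ?_) a
    · simp
    · simp [Fin.succ_succAbove_succ]

/-- Splitting off the first index with `altFaces_cons` leaves the double face sum of a shorter
family, so induction avoids cancelling pairs of faces. -/
theorem altFaces_altFaces {n : ℕ} (c : (Fin n → κ) → G) (σ : Fin (n + 2) → κ) :
    altFaces (altFaces c) σ = 0 := by
  induction n with
  | zero =>
    have h0 : ∀ (c' : (Fin 0 → κ) → G) (τ : Fin 1 → κ), altFaces c' τ = c' Fin.elim0 := by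
      intro c' τ
      rw [altFaces, Fin.sum_univ_succ, Finset.univ_eq_empty, Finset.sum_empty, add_zero,
        Fin.val_zero, pow_zero, one_smul]
      exact congrArg c' (Subsingleton.elim _ _)
    rw [← Fin.cons_self_tail σ, altFaces_cons, h0, h0, sub_eq_zero, h0]
  | succ n ih =>
    rw [← Fin.cons_self_tail σ, altFaces_cons]
    have : (fun τ : Fin (n + 1) → κ => altFaces c (Fin.cons (σ 0) τ : Fin (n + 2) → κ)) =
        c - altFaces fun τ : Fin n → κ => c (Fin.cons (σ 0) τ : Fin (n + 1) → κ) := by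
      funext τ
      exact altFaces_cons c (σ 0) τ
    rw [this, altFaces_sub, ih, sub_zero, sub_self]

end AlternatingCoface

/-! ### Zigzags in a double complex with exact rows and columns -/

section DoubleComplex

variable {A : ℕ → ℕ → Type*} [∀ a b, AddCommGroup (A a b)]
  (d : ∀ a b, A a b →+ A a (b + 1)) (δ : ∀ a b, A a b →+ A (a + 1) b)

/-- In a double complex (without its augmentations): `x` is the sum of the vertical differential of
a horizontally closed element and of the horizontal differential of a vertically closed element. -/
def IsDoubleBoundary : ∀ a b, A a b → Prop
  | 0, 0, x => x = 0
  | 0, b + 1, x => ∃ α : A 0 b, δ 0 b α = 0 ∧ d 0 b α = x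
  | a + 1, 0, x => ∃ β : A a 0, d a 0 β = 0 ∧ δ a 0 β = x
  | a + 1, b + 1, x => ∃ α : A (a + 1) b, ∃ β : A a (b + 1), δ (a + 1) b α = 0 ∧
      d a (b + 1) β = 0 ∧ d (a + 1) b α + δ a (b + 1) β = x

/-- A zigzag from an element `x` of bidegree `(n, b)` to an element `y` of bidegree `(0, m)`. -/
inductive Zigzag : ∀ n b m, A n b → A 0 m → Prop
  | refl (m : ℕ) (y : A 0 m) : Zigzag 0 m m y y
  | step (n b m : ℕ) (θ : A n b) (y : A 0 m) (h : Zigzag n (b + 1) m (d n b θ) y) :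
      Zigzag (n + 1) b m (δ n b θ) y

variable {d δ}

/-- On an edge only one half of the decomposition exists, elsewhere the other half is taken to be
zero; the case distinction is absorbed here. -/
theorem isDoubleBoundary_of_d {a b : ℕ} (α : A a b) (h : δ a b α = 0) :
    IsDoubleBoundary d δ a (b + 1) (d a b α) := by
  cases a with
  | zero => exact ⟨α, h, rfl⟩
  | succ a => exact ⟨α, 0, h, map_zero _, by simp⟩

theorem isDoubleBoundary_of_δ {a b : ℕ} (β : A a b) (h : d a b β = 0) :
    IsDoubleBoundary d δ (a + 1) b (δ a b β) := by
  cases b with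
  | zero => exact ⟨β, h, rfl⟩
  | succ b => exact ⟨0, β, map_zero _, h, by simp⟩

section

variable (dd : ∀ a b x, d a (b + 1) (d a b x) = 0) (δδ : ∀ a b x, δ (a + 1) b (δ a b x) = 0)
  (comm : ∀ a b x, d (a + 1) b (δ a b x) = δ a (b + 1) (d a b x))
  (rows : ∀ a b x, δ (a + 1) b x = 0 → ∃ y, δ a b y = x)
  (cols : ∀ a b x, d a (b + 1) x = 0 → ∃ y, d a b y = x)

include dd comm rows in
-- If `δ θ = d α + δ β` with `δ α = 0` and `d β = 0`, exact rows give `α = δ α'`. Then `θ - d α' -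
-- β` is `δ`-closed and has the same vertical differential as `θ`.
theorem IsDoubleBoundary.d_of_δ {a b : ℕ} {θ : A a b}
    (h : IsDoubleBoundary d δ (a + 1) b (δ a b θ)) :
    IsDoubleBoundary d δ a (b + 1) (d a b θ) := by
  cases b with
  | zero =>
    obtain ⟨β, hβ, hβ'⟩ := h
    have := isDoubleBoundary_of_d (d := d) (δ := δ) (θ - β) (by rw [map_sub, hβ', sub_self])
    rwa [map_sub, hβ, sub_zero] at this
  | succ b =>
    obtain ⟨α, β, hα, hβ, hαβ⟩ := h
    obtain ⟨α', rfl⟩ := rows _ _ _ hα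
    have := isDoubleBoundary_of_d (d := d) (δ := δ) (θ - d a b α' - β)
      (by rw [map_sub, map_sub, ← comm, ← hαβ]; abel)
    rwa [map_sub, map_sub, hβ, dd, sub_zero, sub_zero] at this

include δδ comm cols in
-- The mirror image of `IsDoubleBoundary.d_of_δ`, with exact columns in place of exact rows.
theorem IsDoubleBoundary.δ_of_d {a b : ℕ} {θ : A a b}
    (h : IsDoubleBoundary d δ a (b + 1) (d a b θ)) :
    IsDoubleBoundary d δ (a + 1) b (δ a b θ) := by
  cases a with
  | zero =>
    obtain ⟨α, hα, hα'⟩ := h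
    have := isDoubleBoundary_of_δ (d := d) (δ := δ) (θ - α) (by rw [map_sub, hα', sub_self])
    rwa [map_sub, hα, sub_zero] at this
  | succ a =>
    obtain ⟨α, β, hα, hβ, hαβ⟩ := h
    obtain ⟨β', rfl⟩ := cols _ _ _ hβ
    have := isDoubleBoundary_of_δ (d := d) (δ := δ) (θ - α - δ a b β')
      (by rw [map_sub, map_sub, comm, ← hαβ]; abel)
    rwa [map_sub, map_sub, hα, δδ, sub_zero, sub_zero] at this

include dd δδ comm rows cols in
theorem Zigzag.isDoubleBoundary_iff {n b m : ℕ} {x : A n b} {y : A 0 m}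
    (h : Zigzag d δ n b m x y) : IsDoubleBoundary d δ n b x ↔ IsDoubleBoundary d δ 0 m y := by
  induction h with
  | refl => exact Iff.rfl
  | step n b m θ y h ih =>
    exact ⟨fun h' => ih.1 (h'.d_of_δ dd comm rows), fun h' => (ih.2 h').δ_of_d δδ comm cols⟩

/-- Allows two zigzags with the same starting element to be compared: their difference starts at
zero. -/
theorem Zigzag.sub {n b m : ℕ} {x x' : A n b} {y y' : A 0 m} (h : Zigzag d δ n b m x y)
    (h' : Zigzag d δ n b m x' y') : Zigzag d δ n b m (x - x') (y - y') := by
  induction h with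
  | refl m y =>
    cases h'
    exact .refl _ _
  | step n b m θ y h ih =>
    cases h' with
    | step _ _ _ θ' _ h' =>
      rw [← map_sub]
      refine .step _ _ _ _ _ ?_
      rw [map_sub]
      exact ih h'

include δδ comm cols in
-- Runs a zigzag backwards: an element closed for both differentials is `d θ` by exact columns, and
-- `δ θ` is again closed for both because `d` and `δ` commute.
theorem Zigzag.exists_left {m : ℕ} {y : A 0 m} (hy : d 0 m y = 0) (hy' : δ 0 m y = 0) (n b : ℕ)
    (hnb : n + b = m) : ∃ x : A n b, d n b x = 0 ∧ δ n b x = 0 ∧ Zigzag d δ n b m x y := by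
  induction n generalizing b with
  | zero =>
    obtain rfl : b = m := by omega
    exact ⟨y, hy, hy', .refl _ _⟩
  | succ n ih =>
    obtain ⟨z, hz, hz', hzz⟩ := ih (b + 1) (by omega)
    obtain ⟨θ, rfl⟩ := cols _ _ _ hz
    exact ⟨δ n b θ, by rw [comm, hz'], δδ _ _ _, .step _ _ _ _ _ hzz⟩

end

end DoubleComplex

/-! ### The double complex of Čech cochains of leafwise forms -/

section LeafwiseForms

open TopologicalSpace (Opens)

variable {E : Type*} [NormedAddCommGroup E] [NormedSpace ℝ E]
  {M : Type*} [TopologicalSpace M] [ChartedSpace E M] {p q k : ℕ}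

namespace FormField

open Classical in
/-- The restriction of a form to a set, extended by zero. -/
def cut (W : Set M) (α : FormField E M k) : FormField E M k := fun x => if x ∈ W then α x else 0

theorem cut_of_mem {W : Set M} (α : FormField E M k) {x : M} (hx : x ∈ W) : cut W α x = α x :=
  if_pos hx

theorem cut_of_notMem {W : Set M} (α : FormField E M k) {x : M} (hx : x ∉ W) : cut W α x = 0 :=
  if_neg hx

theorem eventually_cut {W : Set M} (hW : IsOpen W) (α : FormField E M k) {x : M} (hx : x ∈ W) :
    ∀ᶠ y in 𝓝 x, cut W α y = α y := by
  filter_upwards [hW.mem_nhds hx] with y hy using cut_of_mem α hy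

theorem cut_add (W : Set M) (α η : FormField E M k) : cut W (α + η) = cut W α + cut W η := by
  funext x
  by_cases hx : x ∈ W
  · rw [add_apply, cut_of_mem _ hx, cut_of_mem _ hx, cut_of_mem _ hx, add_apply]
  · rw [add_apply, cut_of_notMem _ hx, cut_of_notMem _ hx, cut_of_notMem _ hx, add_zero]

theorem cut_smul (W : Set M) (a : ℝ) (α : FormField E M k) : cut W (a • α) = a • cut W α := by
  funext x
  by_cases hx : x ∈ W
  · rw [smul_apply, cut_of_mem _ hx, cut_of_mem _ hx, smul_apply]
  · rw [smul_apply, cut_of_notMem _ hx, cut_of_notMem _ hx, smul_zero]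

theorem sum_apply {κ : Type*} (s : Finset κ) (α : κ → FormField E M k) (x : M) :
    (∑ i ∈ s, α i) x = ∑ i ∈ s, α i x :=
  Finset.sum_apply x s α

end FormField

namespace Foliation.TransversalDistribution

variable [FiniteDimensional ℝ E] [IsManifold 𝓘(ℝ, E) ∞ M] {F : Foliation E M p q}
  {ν : F.TransversalDistribution}

open FormField

theorem mem_leafwiseForms_iff {W : Opens M} {α : FormField E M k} :
    α ∈ ν.leafwiseForms W k ↔ (∀ x ∈ W, α.SmoothAt x) ∧ (∀ x, ν.leafPart α x = α x) ∧
      ∀ x ∉ W, α x = 0 := by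
  change (α.SmoothOn W ∧ _ ∧ _) ↔ _
  rw [smoothOn_iff_smoothAt W.isOpen]
  refine and_congr_right fun _ => and_congr_left fun _ => ?_
  exact forall_congr' fun x => ν.leafPart_eq_self_iff α x

theorem leafwiseForms_smoothAt {W : Opens M} (α : ν.leafwiseForms W k) {x : M} (hx : x ∈ W) :
    α.1.SmoothAt x :=
  (mem_leafwiseForms_iff.1 α.2).1 x hx

theorem leafwiseForms_eventually_smoothAt {W : Opens M} (α : ν.leafwiseForms W k) {x : M}
    (hx : x ∈ W) : ∀ᶠ y in 𝓝 x, α.1.SmoothAt y := by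
  filter_upwards [W.isOpen.mem_nhds hx] with y hy using leafwiseForms_smoothAt α hy

theorem leafwiseForms_leafPart {W : Opens M} (α : ν.leafwiseForms W k) (x : M) :
    ν.leafPart α.1 x = α.1 x :=
  (mem_leafwiseForms_iff.1 α.2).2.1 x

theorem leafwiseForms_eq_zero {W : Opens M} (α : ν.leafwiseForms W k) {x : M} (hx : x ∉ W) :
    α.1 x = 0 :=
  (mem_leafwiseForms_iff.1 α.2).2.2 x hx

theorem leafwiseForms_ext {W : Opens M} {α η : ν.leafwiseForms W k}
    (h : ∀ x ∈ W, α.1 x = η.1 x) : α = η := by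
  refine Subtype.ext (funext fun x => ?_)
  by_cases hx : x ∈ W
  · exact h x hx
  · rw [leafwiseForms_eq_zero α hx, leafwiseForms_eq_zero η hx]

theorem leafPart_eq_of_eq {α η : FormField E M k} {x : M} (h : α x = η x) :
    ν.leafPart α x = ν.leafPart η x := by
  unfold leafPart
  rw [h]

theorem cut_mem_leafwiseForms {W : Opens M} {α : FormField E M k}
    (hs : ∀ x ∈ W, α.SmoothAt x) (hl : ∀ x ∈ W, ν.leafPart α x = α x) :
    cut W α ∈ ν.leafwiseForms W k := by
  refine mem_leafwiseForms_iff.2 ⟨fun x hx => (hs x hx).congr (eventually_cut W.isOpen α hx),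
    fun x => ?_, fun x hx => cut_of_notMem α hx⟩
  by_cases hx : x ∈ W
  · have h := cut_of_mem (W := (W : Set M)) α hx
    rw [leafPart_eq_of_eq h, h]
    exact hl x hx
  · have h := cut_of_notMem (W := (W : Set M)) α hx
    rw [leafPart_eq_of_eq (η := 0) h, h]
    rfl

variable (ν) in
theorem leafPart_dLeaf (α : FormField E M k) (x : M) : ν.leafPart (ν.dLeaf α) x = ν.dLeaf α x :=
  ν.leafPart_leafPart _ x

variable (ν) in
/-- The leafwise differential `d'' : Ω_{0,k}(W) → Ω_{0,k+1}(W)`. -/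
def dForms (W : Opens M) (k : ℕ) : ν.leafwiseForms W k →+ ν.leafwiseForms W (k + 1) where
  -- The cut is necessary: at a boundary point of `W` the differential of an extension by zero need
  -- not vanish.
  toFun α := ⟨cut W (ν.dLeaf α.1), cut_mem_leafwiseForms
    (fun _ hx => smoothAt_dLeaf ν (leafwiseForms_eventually_smoothAt α hx))
    fun x _ => ν.leafPart_dLeaf _ x⟩
  map_zero' := leafwiseForms_ext fun x hx => (cut_of_mem _ hx).trans (ν.dLeaf_zero x)
  map_add' α η := leafwiseForms_ext fun _ hx => (cut_of_mem (ν.dLeaf (α.1 + η.1)) hx).trans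
    ((dLeaf_add_of_smoothAt (leafwiseForms_smoothAt α hx) (leafwiseForms_smoothAt η hx)).trans
      (congrArg₂ (· + ·) (cut_of_mem (ν.dLeaf α.1) hx) (cut_of_mem (ν.dLeaf η.1) hx)).symm)

theorem dForms_apply {W : Opens M} (α : ν.leafwiseForms W k) {x : M} (hx : x ∈ W) :
    (ν.dForms W k α).1 x = ν.dLeaf α.1 x :=
  cut_of_mem _ hx

theorem dForms_dForms {W : Opens M} (α : ν.leafwiseForms W k) :
    ν.dForms W (k + 1) (ν.dForms W k α) = 0 :=
  leafwiseForms_ext fun x hx => by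
    rw [dForms_apply _ hx]
    refine (dLeaf_congr (η := ν.dLeaf α.1) ?_).trans
      (dLeaf_dLeaf (leafwiseForms_eventually_smoothAt α hx))
    filter_upwards [W.isOpen.mem_nhds hx] with y hy using dForms_apply α hy

theorem dForms_eq_zero_iff {W : Opens M} {α : ν.leafwiseForms W k} :
    ν.dForms W k α = 0 ↔ α.1 ∈ ν.closedForms W k := by
  refine ⟨fun h => ⟨α.2, fun x hx => ?_⟩, fun h => leafwiseForms_ext fun x hx => ?_⟩
  · rw [← dForms_apply α hx, h]
    rfl
  · rw [dForms_apply α hx]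
    exact h.2 x hx

variable (ν) in
/-- The restriction `Ω_{0,k}(W) → Ω_{0,k}(W')`. -/
def resForms {W W' : Opens M} (h : W' ≤ W) (k : ℕ) :
    ν.leafwiseForms W k →ₗ[ℝ] ν.leafwiseForms W' k where
  toFun α := ⟨cut W' α.1, cut_mem_leafwiseForms (fun _ hx => leafwiseForms_smoothAt α (h hx))
    fun x _ => leafwiseForms_leafPart α x⟩
  map_add' _ _ := Subtype.ext (cut_add _ _ _)
  map_smul' _ _ := Subtype.ext (cut_smul _ _ _)

theorem resForms_apply {W W' : Opens M} (h : W' ≤ W) (α : ν.leafwiseForms W k) {x : M}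
    (hx : x ∈ W') : (ν.resForms h k α).1 x = α.1 x :=
  cut_of_mem _ hx

section Cech

variable {ι : Type*} {U : ι → Set M} (hU : ∀ i, IsOpen (U i))

/-- The open set `U_{i₀} ∩ … ∩ U_{i_k}`. -/
def _root_.cechOpens {n : ℕ} (σ : Fin (n + 1) → ι) : Opens M :=
  ⟨cechInter U σ, isOpen_iInter_of_finite fun j => hU (σ j)⟩

theorem _root_.mem_cechOpens {n : ℕ} {σ : Fin (n + 1) → ι} {x : M} :
    x ∈ cechOpens hU σ ↔ ∀ j, x ∈ U (σ j) :=
  Set.mem_iInter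

theorem _root_.cechOpens_face_le {n : ℕ} (σ : Fin (n + 2) → ι) (j : Fin (n + 2)) :
    cechOpens hU σ ≤ cechOpens hU fun a => σ (j.succAbove a) := fun _ hx =>
  (mem_cechOpens hU).2 fun a => (mem_cechOpens hU).1 hx (j.succAbove a)

variable (ν) in
/-- The Čech cochains with values in the leafwise forms. -/
abbrev FormCochain (a b : ℕ) : Type _ :=
  (σ : Fin (a + 1) → ι) → ν.leafwiseForms (cechOpens hU σ) b

variable (ν) in
/-- The leafwise differential of cochains. -/
def cochainD (a b : ℕ) : ν.FormCochain hU a b →+ ν.FormCochain hU a (b + 1) where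
  toFun α σ := ν.dForms _ b (α σ)
  map_zero' := funext fun _ => map_zero _
  map_add' _ _ := funext fun _ => map_add _ _ _

variable (ν) in
/-- The Čech coboundary of cochains. -/
def cochainδ (a b : ℕ) : ν.FormCochain hU a b →+ ν.FormCochain hU (a + 1) b where
  toFun α σ := ∑ j : Fin (a + 2), (-1 : ℝ) ^ (j : ℕ) •
    ν.resForms (cechOpens_face_le hU σ j) b (α fun i => σ (j.succAbove i))
  map_zero' := by
    funext σ
    simp
  map_add' α η := by
    funext σ
    simp [Finset.sum_add_distrib]

variable {hU}

theorem coe_cochainδ {a b : ℕ} (α : ν.FormCochain hU a b) (σ : Fin (a + 2) → ι) :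
    (ν.cochainδ hU a b α σ).1 = ∑ j : Fin (a + 2), (-1 : ℝ) ^ (j : ℕ) •
      (ν.resForms (cechOpens_face_le hU σ j) b (α fun i => σ (j.succAbove i))).1 := by
  simp [cochainδ]

theorem cochainδ_apply {a b : ℕ} (α : ν.FormCochain hU a b) {σ : Fin (a + 2) → ι} {x : M}
    (hx : x ∈ cechOpens hU σ) :
    (ν.cochainδ hU a b α σ).1 x = altFaces (fun τ => (α τ).1 x) σ := by
  rw [coe_cochainδ, FormField.sum_apply]
  refine Finset.sum_congr rfl fun j _ => ?_
  rw [FormField.smul_apply, resForms_apply _ _ hx]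

theorem cochainD_cochainD {a b : ℕ} (α : ν.FormCochain hU a b) :
    ν.cochainD hU a (b + 1) (ν.cochainD hU a b α) = 0 :=
  funext fun _ => dForms_dForms _

theorem cochainδ_cochainδ {a b : ℕ} (α : ν.FormCochain hU a b) :
    ν.cochainδ hU (a + 1) b (ν.cochainδ hU a b α) = 0 :=
  funext fun σ => leafwiseForms_ext fun x hx => by
    rw [cochainδ_apply _ hx]
    refine (altFaces_congr fun j => ?_).trans (altFaces_altFaces (fun τ => (α τ).1 x) σ)
    exact cochainδ_apply α (cechOpens_face_le hU σ j hx)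

/-- The two differentials commute without a sign, so the zigzag relation introduces none either; the
signs of the final formula come only from reordering wedge factors and the final normalisation. -/
theorem cochainD_cochainδ {a b : ℕ} (α : ν.FormCochain hU a b) :
    ν.cochainD hU (a + 1) b (ν.cochainδ hU a b α) =
      ν.cochainδ hU a (b + 1) (ν.cochainD hU a b α) :=
  funext fun σ => leafwiseForms_ext fun x hx => by
    rw [cochainδ_apply _ hx]
    refine (dForms_apply _ hx).trans ?_
    rw [coe_cochainδ, dLeaf_sum fun j _ => (leafwiseForms_smoothAt _ hx).const_smul _]
    refine Finset.sum_congr rfl fun j _ => ?_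
    rw [dLeaf_smul]
    congr 1
    refine Eq.trans (dLeaf_congr ?_) (dForms_apply _ (cechOpens_face_le hU σ j hx)).symm
    filter_upwards [(cechOpens hU σ).isOpen.mem_nhds hx] with y hy using resForms_apply _ _ hy

/-- Exactness of the columns: the primitives provided by acyclicity can be chosen independently on
each intersection. -/
theorem exists_cochainD_eq
    (hacyc : ∀ (m : ℕ) (σ : Fin (m + 1) → ι) (k : ℕ), 0 < k →
      Subsingleton (ν.LeafwiseCohomology (cechOpens hU σ) k))
    {a b : ℕ} (α : ν.FormCochain hU a (b + 1)) (hα : ν.cochainD hU a (b + 1) α = 0) :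
    ∃ η, ν.cochainD hU a b η = α := by
  have h : ∀ σ, ∃ η, ν.dForms (cechOpens hU σ) b η = α σ := by
    intro σ
    have hc : (α σ).1 ∈ ν.closedForms (cechOpens hU σ) (b + 1) :=
      dForms_eq_zero_iff.1 (congrFun hα σ)
    have h0 := (hacyc a σ (b + 1) b.succ_pos).elim (Submodule.Quotient.mk ⟨_, hc⟩) 0
    rw [Submodule.Quotient.mk_eq_zero] at h0
    obtain ⟨_, η, hη, he⟩ : (α σ).1 ∈ ν.exactForms (cechOpens hU σ) (b + 1) := h0
    refine ⟨⟨η, hη⟩, leafwiseForms_ext fun x hx => ?_⟩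
    rw [dForms_apply _ hx]
    exact he x hx
  choose η hη using h
  exact ⟨η, funext hη⟩

end Cech

end Foliation.TransversalDistribution

end LeafwiseForms

/-! ### Exactness of the rows and gluing by the partition of unity -/

section PartitionOfUnity

open TopologicalSpace (Opens)

variable {E : Type*} [NormedAddCommGroup E] [NormedSpace ℝ E] [FiniteDimensional ℝ E]
  {M : Type*} [TopologicalSpace M] [ChartedSpace E M] [IsManifold 𝓘(ℝ, E) ∞ M] {p q k : ℕ}
  {ι : Type*} (h : SmoothPartitionOfUnity ι 𝓘(ℝ, E) M)

open FormField

namespace FormField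

/-- The sum `∑ hᵢ αᵢ`. -/
def partSum (α : ι → FormField E M k) : FormField E M k := fun x => ∑ᶠ i, h i x • α i x

omit [FiniteDimensional ℝ E] [IsManifold 𝓘(ℝ, E) ∞ M] in
theorem partSum_apply (α : ι → FormField E M k) {x : M} {I : Finset ι} (hI : h.finsupport x ⊆ I) :
    partSum h α x = ∑ i ∈ I, h i x • α i x := by
  refine finsum_eq_sum_of_support_subset _ fun i hi => hI ?_
  rw [SmoothPartitionOfUnity.mem_finsupport]
  exact left_ne_zero_of_smul hi

omit [FiniteDimensional ℝ E] [IsManifold 𝓘(ℝ, E) ∞ M] in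
theorem eventually_partSum (α : ι → FormField E M k) (x : M) :
    ∀ᶠ y in 𝓝 x, partSum h α y = (∑ i ∈ h.fintsupport x, fsmul (h i) (α i)) y := by
  filter_upwards [h.eventually_finsupport_subset x] with y hy
  rw [partSum_apply h α hy, FormField.sum_apply]
  rfl

end FormField

omit [FiniteDimensional ℝ E] [IsManifold 𝓘(ℝ, E) ∞ M] in
theorem SmoothPartitionOfUnity.mem_of_mem_fintsupport {h : SmoothPartitionOfUnity ι 𝓘(ℝ, E) M}
    {U : ι → Set M} (hh : h.IsSubordinate U) {x : M} {i : ι} (hi : i ∈ h.fintsupport x) :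
    x ∈ U i :=
  hh i ((h.mem_fintsupport_iff x i).1 hi)

namespace Foliation.TransversalDistribution

variable {F : Foliation E M p q} {ν : F.TransversalDistribution} {h}
  {U : ι → Set M} (hh : h.IsSubordinate U)

include hh in
-- Only indices with `x` in the closed support of `h i` matter near `x`. For these `x ∈ U i`, so `α
-- i` need only be smooth on `W ∩ U i`.
theorem partSum_mem_leafwiseForms {W : Opens M} {α : ι → FormField E M k}
    (hs : ∀ i, ∀ x ∈ W, x ∈ U i → (α i).SmoothAt x) (hl : ∀ i x, ν.leafPart (α i) x = α i x)
    (h0 : ∀ i, ∀ x ∉ W, α i x = 0) : partSum h α ∈ ν.leafwiseForms W k := by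
  refine mem_leafwiseForms_iff.2 ⟨fun x hx => ?_, fun x => ?_, fun x hx => ?_⟩
  · refine SmoothAt.congr (SmoothAt.sum fun i hi => ?_) (eventually_partSum h α x)
    exact (hs i x hx (SmoothPartitionOfUnity.mem_of_mem_fintsupport hh hi)).fsmul
      (h i).contMDiff.contMDiffAt
  · rw [← ν.leafPart_eq_self_iff]
    intro v hv
    have hx : partSum h α x = ∑ i ∈ h.fintsupport x, h i x • α i x :=
      partSum_apply h α (h.finsupport_subset_fintsupport x)
    rw [hx, ContinuousAlternatingMap.sum_apply]
    refine Finset.sum_eq_zero fun i _ => ?_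
    have := (ν.leafPart_eq_self_iff (α i) x).2 (hl i x) v hv
    rw [ContinuousAlternatingMap.smul_apply, this, smul_zero]
  · refine finsum_eq_zero_of_forall_eq_zero fun i => ?_
    rw [h0 i x hx, smul_zero]

variable (hU : ∀ i, IsOpen (U i))

omit [FiniteDimensional ℝ E] [IsManifold 𝓘(ℝ, E) ∞ M] in
theorem _root_.mem_cechOpens_cons {n : ℕ} {σ : Fin (n + 1) → ι} {i : ι} {x : M} :
    x ∈ cechOpens hU (Fin.cons i σ : Fin (n + 2) → ι) ↔ x ∈ U i ∧ x ∈ cechOpens hU σ := by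
  rw [mem_cechOpens, mem_cechOpens, Fin.forall_fin_succ]
  simp

variable (ν)

/-- The contracting homotopy of the Čech complex given by a partition of unity. -/
def cochainK (a b : ℕ) (α : ν.FormCochain hU (a + 1) b) : ν.FormCochain hU a b := fun σ =>
  ⟨partSum h fun i => (α (Fin.cons i σ)).1, partSum_mem_leafwiseForms hh
    (fun _ _ hx hi => leafwiseForms_smoothAt _ ((mem_cechOpens_cons hU).2 ⟨hi, hx⟩))
    (fun _ _ => leafwiseForms_leafPart _ _)
    fun _ _ hx => leafwiseForms_eq_zero _ fun hx' => hx ((mem_cechOpens_cons hU).1 hx').2⟩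

variable {ν hU}

omit [FiniteDimensional ℝ E] [IsManifold 𝓘(ℝ, E) ∞ M] in
theorem _root_.altFaces_sum_smul {κ κ' G : Type*} [AddCommGroup G] [Module ℝ G] {n : ℕ}
    (s : Finset κ') (r : κ' → ℝ) (c : κ' → (Fin n → κ) → G) (σ : Fin (n + 1) → κ) :
    altFaces (fun τ => ∑ i ∈ s, r i • c i τ) σ = ∑ i ∈ s, r i • altFaces (c i) σ := by
  simp only [altFaces, Finset.smul_sum]
  rw [Finset.sum_comm]
  refine Finset.sum_congr rfl fun i _ => Finset.sum_congr rfl fun j _ => ?_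
  rw [smul_comm]

omit [FiniteDimensional ℝ E] [IsManifold 𝓘(ℝ, E) ∞ M] in
theorem _root_.SmoothPartitionOfUnity.mem_of_mem_finsupport
    (hh : h.IsSubordinate U) {x : M} {i : ι} (hi : i ∈ h.finsupport x) : x ∈ U i :=
  SmoothPartitionOfUnity.mem_of_mem_fintsupport hh (h.finsupport_subset_fintsupport x hi)

/-- Evaluated on `(i, σ)`, the cocycle equation says that the face sum of `τ ↦ α (i, τ)` at `σ` is
`α σ`. Averaging over `i` with weights `h i` of sum one gives the claim. -/
theorem cochainδ_cochainK {a b : ℕ} {α : ν.FormCochain hU (a + 1) b}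
    (hα : ν.cochainδ hU (a + 1) b α = 0) : ν.cochainδ hU a b (ν.cochainK hh hU a b α) = α :=
  funext fun σ => leafwiseForms_ext fun x hx => by
    rw [cochainδ_apply _ hx]
    have h1 : (fun τ => (ν.cochainK hh hU a b α τ).1 x) =
        fun τ => ∑ i ∈ h.finsupport x, h i x • (α (Fin.cons i τ)).1 x := by
      funext τ
      exact partSum_apply h _ (Finset.Subset.refl _)
    rw [h1, altFaces_sum_smul]
    have h2 : ∀ i ∈ h.finsupport x,
        h i x • altFaces (fun τ => (α (Fin.cons i τ)).1 x) σ = h i x • (α σ).1 x := by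
      intro i hi
      have hxi : x ∈ cechOpens hU (Fin.cons i σ : Fin (a + 3) → ι) :=
        (mem_cechOpens_cons hU).2 ⟨SmoothPartitionOfUnity.mem_of_mem_finsupport hh hi, hx⟩
      have h3 := cochainδ_apply α hxi
      rw [hα, altFaces_cons] at h3
      have h4 : (α σ).1 x - altFaces (fun τ => (α (Fin.cons i τ)).1 x) σ = 0 := h3.symm
      rw [sub_eq_zero.1 h4]
    rw [Finset.sum_congr rfl h2, ← Finset.sum_smul, h.sum_finsupport x (Set.mem_univ x), one_smul]

variable (ν hU) in
/-- The form on `M` glued from a family of forms on the sets `U i`. -/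
def glue (b : ℕ) (α : ν.FormCochain hU 0 b) : ν.leafwiseForms ⊤ b :=
  ⟨partSum h fun i => (α fun _ => i).1, partSum_mem_leafwiseForms hh
    (fun _ _ _ hi => leafwiseForms_smoothAt _ ((mem_cechOpens hU).2 fun _ => hi))
    (fun _ _ => leafwiseForms_leafPart _ _) fun _ _ hx => (hx trivial).elim⟩

variable (ν hU) in
/-- The family of the restrictions of a form to the sets `U i`. -/
def resGlobal (b : ℕ) (α : ν.leafwiseForms ⊤ b) : ν.FormCochain hU 0 b :=
  fun _ => ν.resForms le_top b α

theorem resGlobal_apply {b : ℕ} (α : ν.leafwiseForms ⊤ b) {σ : Fin 1 → ι} {x : M}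
    (hx : x ∈ cechOpens hU σ) : (ν.resGlobal hU b α σ).1 x = α.1 x :=
  resForms_apply _ _ hx

/-- A degree-zero cocycle has equal values on overlaps, so its weighted average is their common
value. -/
theorem resGlobal_glue {b : ℕ} {α : ν.FormCochain hU 0 b} (hα : ν.cochainδ hU 0 b α = 0) :
    ν.resGlobal hU b (ν.glue hh hU b α) = α :=
  funext fun σ => leafwiseForms_ext fun x hx => by
    rw [resGlobal_apply _ hx]
    have h1 : (ν.glue hh hU b α).1 x = ∑ i ∈ h.finsupport x, h i x • (α fun _ => i).1 x :=
      partSum_apply h _ (Finset.Subset.refl _)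
    have h2 : ∀ i ∈ h.finsupport x, h i x • (α fun _ => i).1 x = h i x • (α σ).1 x := by
      intro i hi
      have hxi : x ∈ cechOpens hU (Fin.cons i σ : Fin 2 → ι) :=
        (mem_cechOpens_cons hU).2 ⟨SmoothPartitionOfUnity.mem_of_mem_finsupport hh hi, hx⟩
      have h3 := cochainδ_apply α hxi
      rw [hα, altFaces_cons, altFaces, Fin.sum_univ_succ, Finset.univ_eq_empty, Finset.sum_empty,
        add_zero, Fin.val_zero, pow_zero, one_smul] at h3
      have h4 : (α σ).1 x - (α (Fin.cons i fun a => σ ((0 : Fin 1).succAbove a))).1 x = 0 := h3.symm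
      have h5 : (Fin.cons i fun a => σ ((0 : Fin 1).succAbove a) : Fin 1 → ι) = fun _ => i := by
        funext j
        refine Fin.cases rfl (fun l => l.elim0) j
      rw [h5] at h4
      rw [sub_eq_zero.1 h4]
    rw [h1, Finset.sum_congr rfl h2, ← Finset.sum_smul, h.sum_finsupport x (Set.mem_univ x), one_smul]

theorem cochainδ_resGlobal {b : ℕ} (α : ν.leafwiseForms ⊤ b) :
    ν.cochainδ hU 0 b (ν.resGlobal hU b α) = 0 :=
  funext fun σ => leafwiseForms_ext fun x hx => by
    rw [cochainδ_apply _ hx]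
    have : altFaces (fun τ : Fin 1 → ι => (ν.resGlobal hU b α τ).1 x) σ =
        altFaces (fun _ : Fin 1 → ι => α.1 x) σ :=
      altFaces_congr fun j => resGlobal_apply _ (cechOpens_face_le hU σ j hx)
    rw [this, altFaces, Fin.sum_univ_two]
    simp

theorem cochainD_resGlobal {b : ℕ} (α : ν.leafwiseForms ⊤ b) :
    ν.cochainD hU 0 b (ν.resGlobal hU b α) = ν.resGlobal hU (b + 1) (ν.dForms ⊤ b α) :=
  funext fun σ => leafwiseForms_ext fun x hx => by
    rw [resGlobal_apply _ hx, dForms_apply _ (Set.mem_univ x : x ∈ (⊤ : Opens M))]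
    refine (dForms_apply _ hx).trans (dLeaf_congr ?_)
    filter_upwards [(cechOpens hU σ).isOpen.mem_nhds hx] with y hy using resGlobal_apply α hy

theorem resGlobal_sub {b : ℕ} (α η : ν.leafwiseForms ⊤ b) :
    ν.resGlobal hU b (α - η) = ν.resGlobal hU b α - ν.resGlobal hU b η :=
  funext fun _ => map_sub _ _ _

include hh in
theorem resGlobal_injective {b : ℕ} : Function.Injective (ν.resGlobal hU b) := by
  intro α η hαη
  refine leafwiseForms_ext fun x _ => ?_
  obtain ⟨i, hi⟩ := h.exists_pos_of_mem (Set.mem_univ x)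
  have hx : x ∈ cechOpens hU fun _ : Fin 1 => i := (mem_cechOpens hU).2 fun _ =>
    SmoothPartitionOfUnity.mem_of_mem_finsupport hh ((h.mem_finsupport x).2 hi.ne')
  rw [← resGlobal_apply α hx, hαη, resGlobal_apply η hx]

include hh in
-- On this edge the primitive must be `δ`-closed, that is, the restriction of a global form, so the
-- predicate amounts to global exactness.
theorem isDoubleBoundary_resGlobal_iff {b : ℕ} (α : ν.leafwiseForms ⊤ b) :
    IsDoubleBoundary (ν.cochainD hU) (ν.cochainδ hU) 0 b (ν.resGlobal hU b α) ↔
      α.1 ∈ ν.exactForms ⊤ b := by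
  cases b with
  | zero =>
    have h0 : ν.resGlobal hU 0 0 = 0 := funext fun _ => map_zero _
    change ν.resGlobal hU 0 α = 0 ↔ α.1 = 0
    rw [← h0, (resGlobal_injective hh).eq_iff, ← Submodule.coe_eq_zero]
  | succ b =>
    constructor
    · rintro ⟨η, hη, hd⟩
      have h1 := cochainD_resGlobal (hU := hU) (ν.glue hh hU b η)
      rw [resGlobal_glue hh hη, hd] at h1
      have h2 := resGlobal_injective hh h1
      refine ⟨α.2, (ν.glue hh hU b η).1, (ν.glue hh hU b η).2, fun x hx => ?_⟩
      rw [h2, dForms_apply _ hx]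
    · rintro ⟨_, η, hη, hd⟩
      refine ⟨ν.resGlobal hU b ⟨η, hη⟩, cochainδ_resGlobal _, ?_⟩
      rw [cochainD_resGlobal]
      congr 1
      exact leafwiseForms_ext fun x hx => (dForms_apply _ hx).trans (hd x hx)

end Foliation.TransversalDistribution

end PartitionOfUnity

/-! ### Čech cochains of `P⁰` as `d''`-closed cochains of zero-forms -/

section ZeroForms

open TopologicalSpace (Opens)

variable {E : Type*} [NormedAddCommGroup E] [NormedSpace ℝ E]
  {M : Type*} [TopologicalSpace M] [ChartedSpace E M] {p q k : ℕ}

open FormField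

/-- A function as a form of degree zero. -/
def FormField.ofFun (f : M → ℝ) : FormField E M 0 := fun x =>
  (f x • wedgeOneForms (fun a : Fin 0 => a.elim0) : E [⋀^Fin 0]→L[ℝ] ℝ)

/-- A form of degree zero as a function. -/
def FormField.toFun (α : FormField E M 0) : M → ℝ := fun x => α.val x 0

theorem FormField.toFun_ofFun (f : M → ℝ) : (ofFun f : FormField E M 0).toFun = f := by
  funext x
  change f x * wedgeOneForms (fun a : Fin 0 => (a.elim0 : E →L[ℝ] ℝ)) 0 = f x
  rw [wedgeOneForms_apply, Matrix.det_fin_zero, mul_one]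

theorem FormField.eq_iff_toFun_eq {α η : FormField E M 0} {x : M} :
    α x = η x ↔ α.toFun x = η.toFun x := by
  refine ⟨fun h => ?_, fun h => ?_⟩
  · unfold toFun val
    rw [h]
  · refine ext_val ?_
    ext v
    rw [Subsingleton.elim v 0]
    exact h

theorem FormField.ofFun_toFun (α : FormField E M 0) : ofFun α.toFun = α := by
  funext x
  rw [eq_iff_toFun_eq, toFun_ofFun]

theorem wedgeOneForms_fin_one_eq_zero_iff {V : Type*} [AddCommGroup V] [Module ℝ V]
    [TopologicalSpace V] (θ : Fin 1 → V →L[ℝ] ℝ) : wedgeOneForms θ = 0 ↔ θ 0 = 0 := by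
  constructor
  · intro h
    ext v
    have h1 : wedgeOneForms θ (fun _ => v) = 0 := by rw [h]; rfl
    rw [wedgeOneForms_apply, Matrix.det_fin_one] at h1
    exact h1
  · intro h
    ext v
    rw [wedgeOneForms_apply, Matrix.det_fin_one, Matrix.of_apply, h]
    rfl

variable [FiniteDimensional ℝ E] [IsManifold 𝓘(ℝ, E) ∞ M] {F : Foliation E M p q}
  {ν : F.TransversalDistribution}

theorem FormField.smoothAt_iff_toFun {α : FormField E M 0} {x : M} :
    α.SmoothAt x ↔ ContMDiffAt 𝓘(ℝ, E) 𝓘(ℝ, ℝ) ∞ α.toFun x := by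
  have hc := isSmoothChart_chartAt (E := E) x
  have hxc := mem_chart_source E x
  constructor
  · intro h
    refine hc.contMDiffAt_of_comp_symm hxc ?_
    have h1 := ContDiffAt.alternatingMap_apply (f := α.coord (chartAt E x)) (v := fun _ _ => 0) h
      fun _ => contDiffAt_const
    convert h1 using 1
    funext y
    exact congrArg (α.val _) (Subsingleton.elim _ _)
  · intro h
    rw [← α.ofFun_toFun]
    have h2 : (ofFun α.toFun : FormField E M 0) =
        fsmul α.toFun (wedgeFun fun a : Fin 0 => a.elim0) := by
      funext x
      rw [eq_iff_toFun_eq]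
      rfl
    rw [h2]
    exact SmoothAt.fsmul h (smoothAt_wedgeFun (Filter.Eventually.of_forall fun _ a => a.elim0))

namespace Foliation.TransversalDistribution

/-- A zero-form is a function times the empty wedge, so the product formula leaves the single factor
`d''f`. -/
theorem dLeaf_eq_zero_iff {α : FormField E M 0} {x : M} (hα : α.SmoothAt x) :
    ν.dLeaf α x = 0 ↔ ν.dLeafFun α.toFun x = 0 := by
  have h2 : α = fsmul α.toFun (ν.leafWedge fun a : Fin 0 => a.elim0) := by
    conv_lhs => rw [← α.ofFun_toFun]
    funext x
    rw [eq_iff_toFun_eq]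
    rfl
  conv_lhs => rw [h2]
  rw [dLeaf_fsmul_leafWedge (smoothAt_iff_toFun.1 hα)
    (Filter.Eventually.of_forall fun _ a => a.elim0), wedgeOneForms_fin_one_eq_zero_iff]
  rfl

variable {ι : Type*} {U : ι → Set M} {hU : ∀ i, IsOpen (U i)}

/-- The functions underlying a cochain of forms of degree zero. -/
def cochainFun {n : ℕ} (α : ν.FormCochain hU n 0) : (Fin (n + 1) → ι) → M → ℝ :=
  fun σ => (α σ).1.toFun

theorem cochainFun_injective {n : ℕ} :
    Function.Injective (cochainFun : ν.FormCochain hU n 0 → _) := by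
  intro α η h
  funext σ
  refine leafwiseForms_ext fun x _ => eq_iff_toFun_eq.2 ?_
  exact congrFun (congrFun h σ) x

theorem cochainFun_mem_iff {n : ℕ} (α : ν.FormCochain hU n 0) :
    cochainFun α ∈ F.cechCochains U n ↔ ν.cochainD hU n 0 α = 0 := by
  have h1 : cochainFun α ∈ F.cechCochains U n ↔
      ∀ σ, cochainFun α σ ∈ F.projectable (cechInter U σ) := by
    simp [cechCochains, Submodule.mem_pi]
  rw [h1, funext_iff]
  refine forall_congr' fun σ => ?_
  refine (ν.mem_projectable_iff (cechOpens hU σ).isOpen).trans ?_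
  constructor
  · rintro ⟨_, h, _⟩
    refine leafwiseForms_ext fun x hx => (dForms_apply (α σ) hx).trans ?_
    exact (dLeaf_eq_zero_iff (leafwiseForms_smoothAt (α σ) hx)).2 (h x hx)
  · intro h
    refine ⟨fun x hx => smoothAt_iff_toFun.1 (leafwiseForms_smoothAt (α σ) hx), fun x hx => ?_,
      fun x hx => ?_⟩
    · refine (dLeaf_eq_zero_iff (leafwiseForms_smoothAt (α σ) hx)).1 ?_
      rw [← dForms_apply (α σ) hx]
      change (ν.cochainD hU n 0 α σ).1 x = 0
      rw [h]
      rfl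
    · exact eq_iff_toFun_eq (η := 0).1 (leafwiseForms_eq_zero (α σ) hx)

variable (ν hU) in
theorem exists_cochainFun_eq {n : ℕ} {c : (Fin (n + 1) → ι) → M → ℝ}
    (hc : c ∈ F.cechCochains U n) :
    ∃ α : ν.FormCochain hU n 0, cochainFun α = c ∧ ν.cochainD hU n 0 α = 0 := by
  have h1 : ∀ σ, c σ ∈ F.projectable (cechInter U σ) := by
    simpa [cechCochains, Submodule.mem_pi] using hc
  have h2 : ∀ σ, (ofFun (c σ) : FormField E M 0) ∈ ν.leafwiseForms (cechOpens hU σ) 0 := by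
    intro σ
    have h3 := (ν.mem_projectable_iff (cechOpens hU σ).isOpen).1 (h1 σ)
    refine mem_leafwiseForms_iff.2 ⟨fun x hx => ?_, fun x => ?_, fun x hx => ?_⟩
    · rw [smoothAt_iff_toFun, toFun_ofFun]
      exact h3.1 x hx
    · rw [eq_iff_toFun_eq]
      change ((ofFun (c σ) : FormField E M 0).val x) _ = _
      exact congrArg _ (Subsingleton.elim _ _)
    · refine eq_iff_toFun_eq (η := 0).2 ?_
      rw [toFun_ofFun]
      exact h3.2.2 x hx
  have h4 : cochainFun (fun σ => ⟨ofFun (c σ), h2 σ⟩ : ν.FormCochain hU n 0) = c :=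
    funext fun σ => toFun_ofFun (c σ)
  refine ⟨_, h4, (cochainFun_mem_iff _).1 ?_⟩
  rwa [h4]

theorem cochainFun_cochainδ {n : ℕ} (α : ν.FormCochain hU n 0) :
    cochainFun (ν.cochainδ hU n 0 α) = cechDelta U n (cochainFun α) := by
  funext σ x
  change (ν.cochainδ hU n 0 α σ).1.toFun x = (cechInter U σ).indicator _ x
  by_cases hx : x ∈ cechOpens hU σ
  · rw [Set.indicator_of_mem (s := cechInter U σ) hx]
    have h1 : (ν.cochainδ hU n 0 α σ).1.val x = altFaces (fun τ => (α τ).1.val x) σ :=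
      cochainδ_apply α hx
    rw [toFun, h1, altFaces, ContinuousAlternatingMap.sum_apply, Finset.sum_apply]
    rfl
  · rw [Set.indicator_of_notMem (s := cechInter U σ) hx]
    exact eq_iff_toFun_eq (η := 0).1 (leafwiseForms_eq_zero _ hx)

omit [FiniteDimensional ℝ E] in
theorem cochainFun_zero {n : ℕ} : cochainFun (0 : ν.FormCochain hU n 0) = 0 := rfl

/-- On this edge the primitive must be `d''`-closed, that is, a cochain of `P⁰`, so the predicate
amounts to being a Čech coboundary. -/
theorem isDoubleBoundary_iff_cochainFun {n : ℕ} (α : ν.FormCochain hU n 0) :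
    IsDoubleBoundary (ν.cochainD hU) (ν.cochainδ hU) n 0 α ↔
      cochainFun α ∈ F.cechCoboundaries U n := by
  cases n with
  | zero =>
    change α = 0 ↔ cochainFun α = 0
    rw [← cochainFun_zero (ν := ν) (hU := hU), cochainFun_injective.eq_iff]
  | succ n =>
    constructor
    · rintro ⟨β, hβ, rfl⟩
      exact ⟨cochainFun β, (cochainFun_mem_iff β).2 hβ, (cochainFun_cochainδ β).symm⟩
    · rintro ⟨b, hb, hd⟩
      obtain ⟨β, rfl, hβ⟩ := exists_cochainFun_eq ν hU hb
      refine ⟨β, hβ, cochainFun_injective ?_⟩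
      rw [cochainFun_cochainδ]
      exact hd

theorem mem_cechCocycles_iff {n : ℕ} (α : ν.FormCochain hU n 0) :
    cochainFun α ∈ F.cechCocycles U n ↔ ν.cochainD hU n 0 α = 0 ∧ ν.cochainδ hU n 0 α = 0 := by
  rw [cechCocycles, Submodule.mem_inf, cochainFun_mem_iff, LinearMap.mem_ker,
    ← cochainFun_cochainδ, ← cochainFun_zero (ν := ν) (hU := hU), cochainFun_injective.eq_iff]

end Foliation.TransversalDistribution

end ZeroForms

/-! ### Rules for wedge products of the forms `d''h i` -/

section ExplicitForm

open TopologicalSpace (Opens)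

section Wedge

variable {V : Type*} [AddCommGroup V] [Module ℝ V] [TopologicalSpace V] {b : ℕ}

theorem wedgeOneForms_eq_zero {θ : Fin b → V →L[ℝ] ℝ} (j : Fin b) (hj : θ j = 0) :
    wedgeOneForms θ = 0 := by
  ext v
  rw [wedgeOneForms_apply]
  refine Matrix.det_eq_zero_of_column_eq_zero j fun i => ?_
  rw [Matrix.of_apply, hj]
  rfl

theorem wedgeOneForms_cons_smul (r : ℝ) (θ₀ : V →L[ℝ] ℝ) (θ : Fin b → V →L[ℝ] ℝ) :
    wedgeOneForms (Fin.cons (r • θ₀) θ : Fin (b + 1) → V →L[ℝ] ℝ) =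
      r • wedgeOneForms (Fin.cons θ₀ θ : Fin (b + 1) → V →L[ℝ] ℝ) := by
  ext v
  rw [ContinuousAlternatingMap.smul_apply, wedgeOneForms_apply, wedgeOneForms_apply,
    Matrix.det_succ_column_zero, Matrix.det_succ_column_zero, Finset.smul_sum]
  refine Finset.sum_congr rfl fun i _ => ?_
  simp only [Matrix.of_apply, Fin.cons_zero, smul_apply, smul_eq_mul]
  have : ∀ θ₁ : V →L[ℝ] ℝ, (Matrix.of fun a b_1 =>
      (Fin.cons θ₁ θ : Fin (b + 1) → V →L[ℝ] ℝ) b_1 (v a)).submatrix i.succAbove Fin.succ =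
      Matrix.of fun a b_1 => θ b_1 (v (i.succAbove a)) := fun θ₁ => rfl
  rw [this, this]
  ring

/-- Moving the first of `b + 1` factors to the end is a cyclic permutation of sign `(-1)^b`. -/
theorem wedgeOneForms_cons (θ₀ : V →L[ℝ] ℝ) (θ : Fin b → V →L[ℝ] ℝ) :
    wedgeOneForms (Fin.cons θ₀ θ : Fin (b + 1) → V →L[ℝ] ℝ) =
      (-1 : ℝ) ^ b • wedgeOneForms (Fin.snoc (α := fun _ => V →L[ℝ] ℝ) θ θ₀) := by
  have hrot : Fin.snoc (α := fun _ => V →L[ℝ] ℝ) θ θ₀ =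
      fun i => (Fin.cons θ₀ θ : Fin (b + 1) → V →L[ℝ] ℝ) (finRotate (b + 1) i) := by
    funext i
    refine Fin.lastCases ?_ (fun j => ?_) i
    · rw [Fin.snoc_last, finRotate_last, Fin.cons_zero]
    · rw [Fin.snoc_castSucc, finRotate_apply, Fin.coeSucc_eq_succ, Fin.cons_succ]
  ext v
  rw [ContinuousAlternatingMap.smul_apply, hrot, wedgeOneForms_apply, wedgeOneForms_apply]
  have h := Matrix.det_permute' (finRotate (b + 1))
    (Matrix.of fun a c => (Fin.cons θ₀ θ : Fin (b + 1) → V →L[ℝ] ℝ) c (v a))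
  rw [sign_finRotate] at h
  have h2 : (Matrix.of fun a c => (Fin.cons θ₀ θ : Fin (b + 1) → V →L[ℝ] ℝ)
      (finRotate (b + 1) c) (v a)) = (Matrix.of fun a c =>
      (Fin.cons θ₀ θ : Fin (b + 1) → V →L[ℝ] ℝ) c (v a)).submatrix id (finRotate (b + 1)) := rfl
  rw [h2, h, smul_eq_mul, ← mul_assoc]
  simp [← mul_pow]

end Wedge

variable {E : Type*} [NormedAddCommGroup E] [NormedSpace ℝ E] [FiniteDimensional ℝ E]
  {M : Type*} [TopologicalSpace M] [ChartedSpace E M] [IsManifold 𝓘(ℝ, E) ∞ M] {p q k : ℕ}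
  {ι : Type*} {h : SmoothPartitionOfUnity ι 𝓘(ℝ, E) M}

open FormField

namespace Foliation.TransversalDistribution

variable {F : Foliation E M p q} {ν : F.TransversalDistribution}
  {U : ι → Set M} (hh : h.IsSubordinate U) {hU : ∀ i, IsOpen (U i)}

theorem dLeafFun_eq_zero_of_notMem_tsupport {f : M → ℝ} {x : M} (hx : x ∉ tsupport f) :
    ν.dLeafFun f x = 0 := by
  have h1 : mfderiv 𝓘(ℝ, E) 𝓘(ℝ, ℝ) f x = 0 := by
    rw [notMem_tsupport_iff_eventuallyEq] at hx
    have h2 : HasMFDerivAt 𝓘(ℝ, E) 𝓘(ℝ, ℝ) (fun _ : M => (0 : ℝ)) x 0 := hasMFDerivAt_const 0 x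
    exact (h2.congr_of_eventuallyEq hx).mfderiv
  rw [dLeafFun, h1]
  rfl

/-- A term survives only if `x` lies in the closed support of every `h (s j)`. Allowing a larger `I`
permits one index set to serve a whole neighbourhood. -/
theorem finsum_smul_leafWedge {b : ℕ} (c : (Fin b → ι) → ℝ) {x : M} {I : Finset ι}
    (hI : h.fintsupport x ⊆ I) :
    ∑ᶠ s : Fin b → ι, c s • ν.leafWedge (fun j => h (s j)) x =
      ∑ s ∈ Fintype.piFinset fun _ : Fin b => I, c s • ν.leafWedge (fun j => h (s j)) x := by
  refine finsum_eq_sum_of_support_subset _ fun s hs => ?_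
  rw [Finset.mem_coe, Fintype.mem_piFinset]
  intro j
  by_contra hj
  refine right_ne_zero_of_smul hs (wedgeOneForms_eq_zero j ?_)
  exact dLeafFun_eq_zero_of_notMem_tsupport fun hx =>
    hj (hI ((h.mem_fintsupport_iff x (s j)).2 hx))

theorem dLeafFun_mul {f g : M → ℝ} {x : M} (r : ℝ)
    (hf : MDifferentiableAt 𝓘(ℝ, E) 𝓘(ℝ, ℝ) f x) (hg : MDifferentiableAt 𝓘(ℝ, E) 𝓘(ℝ, ℝ) g x)
    (hg0 : ν.dLeafFun g x = 0) :
    ν.dLeafFun (fun y => r * (f y * g y)) x = (r * g x) • ν.dLeafFun f x := by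
  have h1 := (hf.hasMFDerivAt.mul hg.hasMFDerivAt).const_smul r
  have h2 : (mfderiv 𝓘(ℝ, E) 𝓘(ℝ, ℝ) g x : E →L[ℝ] ℝ).comp (ν.projModel x) = 0 := hg0
  have h3 : mfderiv 𝓘(ℝ, E) 𝓘(ℝ, ℝ) (fun y => r * (f y * g y)) x = _ := h1.mfderiv
  have h4 : (funDeriv E (fun y => r * (f y * g y)) x).comp (ν.projModel x) =
      (r * g x) • (funDeriv E f x).comp (ν.projModel x) := by
    ext v
    have h5 := DFunLike.congr_fun h3 (ν.projModel x v)
    refine h5.trans ?_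
    have h6 : funDeriv E g x (ν.projModel x v) = 0 := DFunLike.congr_fun h2 v
    change r * (f x * funDeriv E g x (ν.projModel x v) +
      g x * funDeriv E f x (ν.projModel x v)) = r * g x * funDeriv E f x (ν.projModel x v)
    rw [h6]
    ring
  exact h4

end Foliation.TransversalDistribution

end ExplicitForm

/-! ### The zigzag computed with the partition of unity -/

section ExplicitZigzag

open TopologicalSpace (Opens)

variable {E : Type*} [NormedAddCommGroup E] [NormedSpace ℝ E] [FiniteDimensional ℝ E]
  {M : Type*} [TopologicalSpace M] [ChartedSpace E M] [IsManifold 𝓘(ℝ, E) ∞ M] {p q k : ℕ}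
  {ι : Type*} {h : SmoothPartitionOfUnity ι 𝓘(ℝ, E) M}

open FormField

theorem Fintype.sum_piFinset_snoc {G : Type*} [AddCommMonoid G] {b : ℕ} (I : Finset ι)
    (f : (Fin (b + 1) → ι) → G) :
    ∑ s ∈ Fintype.piFinset (fun _ : Fin (b + 1) => I), f s =
      ∑ t ∈ I ×ˢ Fintype.piFinset (fun _ : Fin b => I),
        f (Fin.snoc (α := fun _ => ι) t.2 t.1) := by
  refine Finset.sum_nbij' (fun s => (s (Fin.last b), Fin.init s))
    (fun t => Fin.snoc (α := fun _ => ι) t.2 t.1) ?_ ?_ ?_ ?_ ?_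
  · intro s hs
    rw [Fintype.mem_piFinset] at hs
    rw [Finset.mem_product, Fintype.mem_piFinset]
    exact ⟨hs _, fun j => hs j.castSucc⟩
  · intro t ht
    rw [Finset.mem_product, Fintype.mem_piFinset] at ht
    rw [Fintype.mem_piFinset]
    refine fun j => Fin.lastCases ?_ (fun l => ?_) j
    · rw [Fin.snoc_last]
      exact ht.1
    · rw [Fin.snoc_castSucc]
      exact ht.2 l
  · exact fun s _ => Fin.snoc_init_self s
  · rintro ⟨i, s⟩ _
    rw [Fin.snoc_last, Fin.init_snoc]
  · exact fun s _ => congrArg f (Fin.snoc_init_self s).symm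

namespace Foliation.TransversalDistribution

variable {F : Foliation E M p q} {ν : F.TransversalDistribution}
  {U : ι → Set M} (hh : h.IsSubordinate U) {hU : ∀ i, IsOpen (U i)}

/-- The leafwise differential of the product of functions with `d''g₁ ∧ … ∧ d''g_b`, when the second
function is constant along the leaves. -/
theorem dLeaf_fsmul_mul_leafWedge {b : ℕ} {f g : M → ℝ} {gs : Fin b → M → ℝ} {x : M} (r : ℝ)
    (hf : ContMDiffAt 𝓘(ℝ, E) 𝓘(ℝ, ℝ) ∞ f x) (hg : ContMDiffAt 𝓘(ℝ, E) 𝓘(ℝ, ℝ) ∞ g x)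
    (hgs : ∀ a, ContMDiff 𝓘(ℝ, E) 𝓘(ℝ, ℝ) ∞ (gs a)) (hg0 : ν.dLeafFun g x = 0) :
    ν.dLeaf (fsmul (fun y => r * (f y * g y)) (ν.leafWedge gs)) x =
      (((-1) ^ b * r) * g x) •
        ν.leafWedge (Fin.snoc (α := fun _ => M → ℝ) gs f) x := by
  have hfg : ContMDiffAt 𝓘(ℝ, E) 𝓘(ℝ, ℝ) ∞ (fun y => r * (f y * g y)) x :=
    contMDiffAt_const.mul (hf.mul hg)
  refine (dLeaf_fsmul_leafWedge hfg (Filter.Eventually.of_forall fun y a => (hgs a) y)).trans ?_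
  rw [dLeafFun_mul r (hf.mdifferentiableAt (by simp)) (hg.mdifferentiableAt (by simp)) hg0]
  have h1 : (fun a => ν.dLeafFun ((Fin.snoc (α := fun _ => M → ℝ) gs f : Fin (b + 1) → M → ℝ) a) x) =
      Fin.snoc (α := fun _ => TangentSpace 𝓘(ℝ, E) x →L[ℝ] ℝ) (fun a => ν.dLeafFun (gs a) x)
        (ν.dLeafFun f x) := by
    funext j
    refine Fin.lastCases ?_ (fun l => ?_) j
    · rw [Fin.snoc_last, Fin.snoc_last]
    · rw [Fin.snoc_castSucc, Fin.snoc_castSucc]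
  unfold leafWedge
  rw [h1]
  refine (wedgeOneForms_cons_smul (V := E) _ _ _).trans ?_
  refine (congrArg _ (wedgeOneForms_cons (V := E) _ _)).trans ?_
  refine (smul_smul _ _ _).trans ?_
  congr 1
  ring

/-- One step of the explicit zigzag. The homotopy absorbs the first Čech index `i` with weight `h
i`, `d''` differentiates only this weight, and `d''h i` is moved behind the `b` existing factors, so
`i` becomes the last entry of `s`. -/
theorem cochainD_cochainK_apply {a b : ℕ} (α : ν.FormCochain hU (a + 1) b) (r : ℝ)
    (c : (Fin b → ι) → (Fin (a + 2) → ι) → M → ℝ)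
    (hc : ∀ s τ x, (∀ j, x ∈ U (s j)) → x ∈ cechOpens hU τ →
      ContMDiffAt 𝓘(ℝ, E) 𝓘(ℝ, ℝ) ∞ (c s τ) x ∧ ν.dLeafFun (c s τ) x = 0)
    (hα : ∀ τ, ∀ x ∈ cechOpens hU τ,
      (α τ).1 x = r • ∑ᶠ s, c s τ x • ν.leafWedge (fun j => h (s j)) x)
    {σ : Fin (a + 1) → ι} {x : M} (hx : x ∈ cechOpens hU σ) :
    (ν.cochainD hU a b (ν.cochainK hh hU a b α) σ).1 x =
      ((-1) ^ b * r) • ∑ᶠ s : Fin (b + 1) → ι,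
        c (Fin.init s) (Fin.cons (s (Fin.last b)) σ) x • ν.leafWedge (fun j => h (s j)) x := by
  refine (dForms_apply _ hx).trans ?_
  set I := h.fintsupport x with hI
  have hIU : ∀ i ∈ I, x ∈ U i := fun i hi => SmoothPartitionOfUnity.mem_of_mem_fintsupport hh hi
  set T := I ×ˢ Fintype.piFinset (fun _ : Fin b => I) with hT
  have hTU : ∀ t ∈ T, x ∈ U t.1 ∧ ∀ j, x ∈ U (t.2 j) := by
    intro t ht
    rw [Finset.mem_product, Fintype.mem_piFinset] at ht
    exact ⟨hIU _ ht.1, fun j => hIU _ (ht.2 j)⟩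
  have hcT : ∀ t ∈ T, ContMDiffAt 𝓘(ℝ, E) 𝓘(ℝ, ℝ) ∞ (c t.2 (Fin.cons t.1 σ)) x ∧
      ν.dLeafFun (c t.2 (Fin.cons t.1 σ)) x = 0 := fun t ht =>
    hc _ _ x (hTU t ht).2 ((mem_cechOpens_cons hU).2 ⟨(hTU t ht).1, hx⟩)
  -- The index sets are frozen at those of `x`, so that near `x` the cochain is one fixed finite sum
  -- and can be differentiated term by term.
  have hev : ∀ᶠ y in 𝓝 x, (ν.cochainK hh hU a b α σ).1 y =
      (∑ t ∈ T, fsmul (fun y => r * (h t.1 y * c t.2 (Fin.cons t.1 σ) y))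
        (ν.leafWedge fun j => h (t.2 j))) y := by
    filter_upwards [h.eventually_finsupport_subset x, h.eventually_fintsupport_subset x,
      (cechOpens hU σ).isOpen.mem_nhds hx] with y hy hy' hyσ
    refine (partSum_apply h _ hy).trans ?_
    rw [FormField.sum_apply, hT, Finset.sum_product]
    refine Finset.sum_congr rfl fun i _ => ?_
    -- The formula for `α` is available only on `U i`, which `y` may have left; the weight then
    -- vanishes.
    by_cases hi : h i y = 0
    · rw [hi, zero_smul]
      symm
      refine Finset.sum_eq_zero fun s _ => ?_
      rw [fsmul_apply, hi, zero_mul, mul_zero, zero_smul]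
    · have hyi : y ∈ U i := SmoothPartitionOfUnity.mem_of_mem_finsupport hh
        ((h.mem_finsupport y).2 hi)
      rw [hα _ y ((mem_cechOpens_cons hU).2 ⟨hyi, hyσ⟩), finsum_smul_leafWedge _ hy',
        Finset.smul_sum, Finset.smul_sum]
      refine Finset.sum_congr rfl fun s _ => ?_
      rw [fsmul_apply, smul_smul, smul_smul]
      congr 1
      ring
  rw [dLeaf_congr hev, dLeaf_sum, finsum_smul_leafWedge _ (Finset.Subset.refl I),
    Fintype.sum_piFinset_snoc, Finset.smul_sum]
  · refine Finset.sum_congr rfl fun t ht => ?_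
    rw [dLeaf_fsmul_mul_leafWedge r (h t.1).contMDiff.contMDiffAt (hcT t ht).1
      (fun j => (h (t.2 j)).contMDiff) (hcT t ht).2, smul_smul, Fin.snoc_last, Fin.init_snoc]
    have h1 : Fin.snoc (α := fun _ => M → ℝ) (fun j => ⇑(h (t.2 j))) (h t.1) =
        fun j => ⇑(h ((Fin.snoc (α := fun _ => ι) t.2 t.1 : Fin (b + 1) → ι) j)) := by
      funext j
      refine Fin.lastCases ?_ (fun l => ?_) j
      · rw [Fin.snoc_last, Fin.snoc_last]
      · rw [Fin.snoc_castSucc, Fin.snoc_castSucc]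
    rw [h1]
  · intro t ht
    refine (smoothAt_leafWedge (Filter.Eventually.of_forall fun y j =>
      (h (t.2 j)).contMDiff y)).fsmul ?_
    exact contMDiffAt_const.mul ((h t.1).contMDiff.contMDiffAt.mul (hcT t ht).1)

include hh in
/-- The zigzag from a Čech cocycle to a family of leafwise forms. -/
theorem exists_zigzag {c : (Fin (k + 1) → ι) → M → ℝ} (hc : c ∈ F.cechCochains U k) (a b : ℕ)
    (hab : a + b = k) (α : ν.FormCochain hU a b) (hαd : ν.cochainD hU a b α = 0)
    (hαδ : ν.cochainδ hU a b α = 0)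
    (hα : ∀ σ, ∀ x ∈ cechOpens hU σ, (α σ).1 x =
      (-1 : ℝ) ^ (∑ j ∈ Finset.range b, j) • ∑ᶠ s : Fin b → ι,
        c (fun j => Fin.append s σ (Fin.cast (by omega) j)) x •
          ν.leafWedge (fun j => h (s j)) x) :
    ∃ η : ν.FormCochain hU 0 k, ν.cochainD hU 0 k η = 0 ∧ ν.cochainδ hU 0 k η = 0 ∧
      Zigzag (ν.cochainD hU) (ν.cochainδ hU) a b k α η ∧
      ∀ σ, ∀ x ∈ cechOpens hU σ, (η σ).1 x =
        (-1 : ℝ) ^ (∑ j ∈ Finset.range k, j) • ∑ᶠ s : Fin k → ι,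
          c (Fin.snoc (α := fun _ => ι) s (σ 0)) x • ν.leafWedge (fun j => h (s j)) x := by
  induction a generalizing b with
  | zero =>
    obtain rfl : b = k := by omega
    refine ⟨α, hαd, hαδ, .refl _ _, fun σ x hx => ?_⟩
    rw [hα σ x hx]
    refine congrArg _ (finsum_congr fun s => ?_)
    congr 2
    rw [Fin.append_right_eq_snoc]
    rfl
  | succ a ih =>
    -- The homotopy supplies `θ` with `δ θ = α`, and induction continues with `d'' θ`.
    have h1 := cochainδ_cochainK hh hαδ
    obtain ⟨η, hη, hη', hz, hf⟩ := ih (b + 1) (by omega)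
      (ν.cochainD hU a b (ν.cochainK hh hU a b α)) (cochainD_cochainD _)
      (by rw [← cochainD_cochainδ, h1, hαd]) (by
        intro σ x hx
        rw [cochainD_cochainK_apply hh α _ (fun s τ => c fun j =>
          Fin.append s τ (Fin.cast (by omega) j)) ?_ hα hx]
        · refine congrArg₂ (· • ·) (by rw [Finset.sum_range_succ, pow_add, mul_comm]) (finsum_congr fun s => ?_)
          congr 2
          funext j
          -- The absorbed index passes from the front of `σ` to the end of `s`, so the concatenated
          -- tuple indexing `c` is unchanged.
          conv_rhs => rw [← Fin.snoc_init_self s, Fin.append_left_snoc]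
          rfl
        · intro s τ x hs hτ
          have hk : k + 1 = b + (a + 1 + 1) := by omega
          have h2 : c (fun j => Fin.append s τ (Fin.cast hk j)) ∈ F.projectable
              (cechInter U fun j => Fin.append s τ (Fin.cast hk j)) := by
            have := hc
            simp only [cechCochains, Submodule.mem_pi] at this
            exact this _ trivial
          have h3 := (ν.mem_projectable_iff (cechOpens hU _).isOpen).1 h2
          have h4 : x ∈ cechInter U fun j : Fin (k + 1) =>
              Fin.append s τ (Fin.cast hk j) := by
            refine Set.mem_iInter.2 fun j => ?_
            have h5 : ∀ l, x ∈ U (Fin.append s τ l) := by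
              intro l
              refine Fin.addCases (fun l => ?_) (fun l => ?_) l
              · rw [Fin.append_left]
                exact hs l
              · rw [Fin.append_right]
                exact (mem_cechOpens hU).1 hτ l
            exact h5 _
          exact ⟨h3.1 x h4, h3.2.1 x h4⟩)
    refine ⟨η, hη, hη', ?_, hf⟩
    have := Zigzag.step a b k _ η hz
    rwa [h1] at this

end Foliation.TransversalDistribution

end ExplicitZigzag

/-! ### The comparison isomorphism -/

section CechLeafwise

open TopologicalSpace (Opens)

theorem exists_quotientEquiv {V V' : Type*} [AddCommGroup V] [Module ℝ V] [AddCommGroup V']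
    [Module ℝ V'] (f : V →ₗ[ℝ] V') (S : Submodule ℝ V) (S' : Submodule ℝ V')
    (hS : ∀ x, f x ∈ S' ↔ x ∈ S) (hf : ∀ y, ∃ x, f x - y ∈ S') :
    ∃ Φ : (V ⧸ S) ≃ₗ[ℝ] (V' ⧸ S'), ∀ x,
      Φ (Submodule.Quotient.mk x) = Submodule.Quotient.mk (f x) := by
  refine ⟨LinearEquiv.ofBijective (S.mapQ S' f fun x hx => (hS x).2 hx) ⟨?_, ?_⟩, fun x => rfl⟩
  · rw [← LinearMap.ker_eq_bot, LinearMap.ker_eq_bot']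
    intro z hz
    obtain ⟨x, rfl⟩ := Submodule.Quotient.mk_surjective _ z
    rw [Submodule.mapQ_apply, Submodule.Quotient.mk_eq_zero, hS] at hz
    exact (Submodule.Quotient.mk_eq_zero _).2 hz
  · intro z
    obtain ⟨y, rfl⟩ := Submodule.Quotient.mk_surjective _ z
    obtain ⟨x, hx⟩ := hf y
    exact ⟨Submodule.Quotient.mk x, (Submodule.Quotient.eq _).2 hx⟩

variable {E : Type*} [NormedAddCommGroup E] [NormedSpace ℝ E] [FiniteDimensional ℝ E]
  {M : Type*} [TopologicalSpace M] [ChartedSpace E M] [IsManifold 𝓘(ℝ, E) ∞ M] {p q k : ℕ}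
  {ι : Type*} {h : SmoothPartitionOfUnity ι 𝓘(ℝ, E) M}

open FormField

namespace Foliation.TransversalDistribution

variable {F : Foliation E M p q} {ν : F.TransversalDistribution}
  {U : ι → Set M} (hh : h.IsSubordinate U) {hU : ∀ i, IsOpen (U i)}

theorem cechForm_apply (c : (Fin (k + 1) → ι) → M → ℝ) (i : ι) (x : M) :
    ν.cechForm (fun i => ⇑(h i)) c i x = (-1 : ℝ) ^ (k * (k + 1) / 2) •
      ∑ s ∈ Fintype.piFinset fun _ : Fin k => h.fintsupport x,
        c (Fin.snoc (α := fun _ => ι) s i) x • ν.leafWedge (fun j => h (s j)) x :=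
  congrArg _ (finsum_smul_leafWedge _ (Finset.Subset.refl _))

theorem cechForm_add (c c' : (Fin (k + 1) → ι) → M → ℝ) (i : ι) (x : M) :
    ν.cechForm (fun i => ⇑(h i)) (c + c') i x =
      ν.cechForm (fun i => ⇑(h i)) c i x + ν.cechForm (fun i => ⇑(h i)) c' i x := by
  rw [cechForm_apply, cechForm_apply, cechForm_apply, ← smul_add, ← Finset.sum_add_distrib]
  refine congrArg _ (Finset.sum_congr rfl fun s _ => ?_)
  rw [Pi.add_apply, Pi.add_apply, add_smul]

theorem cechForm_smul (r : ℝ) (c : (Fin (k + 1) → ι) → M → ℝ) (i : ι) (x : M) :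
    ν.cechForm (fun i => ⇑(h i)) (r • c) i x = r • ν.cechForm (fun i => ⇑(h i)) c i x := by
  rw [cechForm_apply, cechForm_apply, smul_comm]
  refine congrArg _ (Eq.trans (Finset.sum_congr rfl fun s _ => ?_) (Finset.smul_sum).symm)
  rw [Pi.smul_apply, Pi.smul_apply, smul_eq_mul, mul_smul]

include hh in
-- Besides the normalised form, the endpoint `ξ` of the zigzag is retained: the double-complex
-- argument applies to `ξ`, the stated formula to `(-1)^k • ξ`.
theorem exists_zigzag_cechForm {c : (Fin (k + 1) → ι) → M → ℝ} (hc : c ∈ F.cechCocycles U k) :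
    ∃ ω' : ν.closedForms ⊤ k, (∀ i, ∀ x ∈ U i, ω'.1 x = ν.cechForm (fun i => ⇑(h i)) c i x) ∧
      ∃ α : ν.FormCochain hU k 0, ∃ ξ : ν.leafwiseForms ⊤ k, cochainFun α = c ∧
        Zigzag (ν.cochainD hU) (ν.cochainδ hU) k 0 k α (ν.resGlobal hU k ξ) ∧
          ω'.1 = (-1 : ℝ) ^ k • ξ.1 := by
  obtain ⟨α, rfl, hα⟩ := exists_cochainFun_eq ν hU hc.1
  have hα' := ((mem_cechCocycles_iff α).1 hc).2
  obtain ⟨η, hη, hη', hz, hf⟩ := exists_zigzag hh hc.1 k 0 rfl α hα hα' (by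
    intro σ x hx
    rw [Finset.range_zero, Finset.sum_empty, pow_zero, one_smul, finsum_unique,
      Fin.append_left_nil _ _ rfl]
    exact congrFun (ofFun_toFun (α σ).1).symm x)
  have hg := resGlobal_glue hh hη'
  set ξ := ν.glue hh hU k η
  have hξ : ξ.1 ∈ ν.closedForms ⊤ k := by
    refine dForms_eq_zero_iff.1 (resGlobal_injective (hU := hU) hh ?_)
    rw [← cochainD_resGlobal, hg, hη]
    exact (funext fun _ => map_zero _).symm
  refine ⟨⟨(-1 : ℝ) ^ k • ξ.1, Submodule.smul_mem _ _ hξ⟩, fun i x hx => ?_, α, ξ, rfl, ?_, rfl⟩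
  · have hx' : x ∈ cechOpens hU fun _ : Fin 1 => i := (mem_cechOpens hU).2 fun _ => hx
    have h0 : ξ.1 x = (η fun _ => i).1 x := by rw [← resGlobal_apply ξ hx', hg]
    have h1 := h0.trans (hf _ x hx')
    refine (congrArg _ h1).trans ((smul_smul _ _ _).trans ?_)
    -- The exponent becomes `0 + 1 + ⋯ + k`, which accounts for the extra factor `(-1)^k`.
    have h2 : (-1 : ℝ) ^ k * (-1) ^ (∑ j ∈ Finset.range k, j) = (-1) ^ (k * (k + 1) / 2) := by
      rw [← pow_add, add_comm, ← Finset.sum_range_succ, Finset.sum_range_id, Nat.add_sub_cancel,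
        mul_comm]
    rw [h2]
    rfl
  · rwa [hg]

end Foliation.TransversalDistribution

end CechLeafwise

open Foliation.TransversalDistribution in
theorem proposition1 {E : Type*} [NormedAddCommGroup E] [NormedSpace ℝ E] [FiniteDimensional ℝ E]
    {M : Type*} [TopologicalSpace M] [ChartedSpace E M] [IsManifold 𝓘(ℝ, E) ∞ M]
    [T2Space M] [ParacompactSpace M]
    {p q : ℕ} (F : Foliation E M p q) (ν : F.TransversalDistribution)
    {ι : Type*} (U : ι → Set M) (hU : ν.IsGoodCovering U)
    (h : SmoothPartitionOfUnity ι 𝓘(ℝ, E) M) (hh : h.IsSubordinate U) (k : ℕ) :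
    ∃ Ω : F.cechCocycles U k →ₗ[ℝ] ν.closedForms ⊤ k,
      (∀ (c : F.cechCocycles U k) (i : ι), ∀ x ∈ U i,
        (Ω c : FormField E M k) x =
          ν.cechForm (fun i => ⇑(h i)) (c : (Fin (k + 1) → ι) → M → ℝ) i x) ∧
      ∃ Φ : F.CechCohomology U k ≃ₗ[ℝ] ν.LeafwiseCohomology ⊤ k,
        ∀ c : F.cechCocycles U k,
          Φ (Submodule.Quotient.mk c) = Submodule.Quotient.mk (Ω c) := by
  choose Ω hΩ α ξ hα hz hξ using fun c : F.cechCocycles U k =>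
    exists_zigzag_cechForm (ν := ν) hh (hU := hU.isOpen) c.2
  have hcov : ∀ x, ∃ i, x ∈ U i := fun x => by
    have := hU.covers.symm.subset (Set.mem_univ x)
    simpa using this
  -- The chosen forms depend linearly on `c` because their values are prescribed on a covering by
  -- expressions linear in `c`.
  let ΩL : F.cechCocycles U k →ₗ[ℝ] ν.closedForms ⊤ k :=
    { toFun := Ω
      map_add' := fun c c' => Subtype.ext <| funext fun x => by
        obtain ⟨i, hi⟩ := hcov x
        refine (hΩ _ i x hi).trans ((cechForm_add c.1 c'.1 i x).trans ?_)
        exact congrArg₂ (· + ·) (hΩ c i x hi).symm (hΩ c' i x hi).symm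
      map_smul' := fun r c => Subtype.ext <| funext fun x => by
        obtain ⟨i, hi⟩ := hcov x
        refine (hΩ _ i x hi).trans ((cechForm_smul r c.1 i x).trans ?_)
        exact congrArg _ (hΩ c i x hi).symm }
  have rows : ∀ a b (x : ν.FormCochain hU.isOpen (a + 1) b),
      ν.cochainδ hU.isOpen (a + 1) b x = 0 → ∃ y, ν.cochainδ hU.isOpen a b y = x :=
    fun a b x hx => ⟨ν.cochainK hh hU.isOpen a b x, cochainδ_cochainK hh hx⟩
  have cols : ∀ a b (x : ν.FormCochain hU.isOpen a (b + 1)),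
      ν.cochainD hU.isOpen a (b + 1) x = 0 → ∃ y, ν.cochainD hU.isOpen a b y = x :=
    fun a b x hx => exists_cochainD_eq hU.acyclic x hx
  have key : ∀ (α : ν.FormCochain hU.isOpen k 0) (ξ : ν.leafwiseForms ⊤ k),
      Zigzag (ν.cochainD hU.isOpen) (ν.cochainδ hU.isOpen) k 0 k α (ν.resGlobal hU.isOpen k ξ) →
      (cochainFun α ∈ F.cechCoboundaries U k ↔ ξ.1 ∈ ν.exactForms ⊤ k) := by
    intro α ξ hz
    rw [← isDoubleBoundary_iff_cochainFun, ← isDoubleBoundary_resGlobal_iff hh (hU := hU.isOpen)]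
    exact hz.isDoubleBoundary_iff (fun _ _ => cochainD_cochainD) (fun _ _ => cochainδ_cochainδ)
      (fun _ _ => cochainD_cochainδ) rows cols
  have hsq : ∀ ξ : FormField E M k, (-1 : ℝ) ^ k • (-1 : ℝ) ^ k • ξ = ξ := fun ξ => by
    rw [smul_smul, ← mul_pow, neg_one_mul, neg_neg, one_pow, one_smul]
  refine ⟨ΩL, hΩ, exists_quotientEquiv ΩL _ _ (fun c => ?_) fun η => ?_⟩
  · change (Ω c).1 ∈ ν.exactForms ⊤ k ↔ c.1 ∈ F.cechCoboundaries U k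
    rw [← hα c, key _ _ (hz c), hξ c]
    exact Submodule.smul_mem_iff _ (pow_ne_zero _ (neg_ne_zero.2 one_ne_zero))
  -- For surjectivity a zigzag is run backwards from `(-1)^k • η`, the factor compensating the
  -- normalisation of `Ω`.
  · let ξ' : ν.leafwiseForms ⊤ k := (-1 : ℝ) ^ k • ⟨η.1, η.2.1⟩
    have hξ' : ν.dForms ⊤ k ξ' = 0 :=
      dForms_eq_zero_iff.2 (Submodule.smul_mem _ ((-1 : ℝ) ^ k) η.2)
    obtain ⟨β, hβ, hβ', hzβ⟩ := Zigzag.exists_left (d := ν.cochainD hU.isOpen)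
      (δ := ν.cochainδ hU.isOpen) (fun _ _ => cochainδ_cochainδ) (fun _ _ => cochainD_cochainδ) cols
      (y := ν.resGlobal hU.isOpen k ξ')
      (by rw [cochainD_resGlobal, hξ']; exact funext fun _ => map_zero _)
      (cochainδ_resGlobal _) k 0 rfl
    let c : F.cechCocycles U k := ⟨cochainFun β, (mem_cechCocycles_iff β).2 ⟨hβ, hβ'⟩⟩
    refine ⟨c, ?_⟩
    have h1 : α c = β := cochainFun_injective (hα c)
    -- The explicit and the backward zigzag both start at `β`, so their difference joins `0` to `ξ c
    -- - ξ'`, which is therefore exact.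
    have h2 := (hz c).sub hzβ
    rw [← resGlobal_sub, h1, sub_self] at h2
    have h3 : (ξ c - ξ').1 ∈ ν.exactForms ⊤ k := (key _ _ h2).1 (zero_mem _)
    change (Ω c).1 - η.1 ∈ ν.exactForms ⊤ k
    have h4 : (Ω c).1 - η.1 = (-1 : ℝ) ^ k • (ξ c - ξ').1 := by
      rw [hξ c]
      change _ = (-1 : ℝ) ^ k • ((ξ c).1 - (-1 : ℝ) ^ k • η.1)
      rw [smul_sub, hsq]
    rw [h4]
    exact Submodule.smul_mem _ _ h3

end
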